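/- Let $\mathcal L\subset\mathbb R^{2n}=\{(P,Q)\}$ be a $k$-dimensional subspace, isotropic for $\omega((P,Q),(P',Q'))=\sum_j(P_jQ'_j-P'_jQ_j)$, with a shift-invariant (Haar) measure $d\mu$, and suppose that $(P,Q)\mapsto Q$ is injective on $\mathcal L$ (i.e. $\mathcal L$ projects uniquely to the plane $P=0$). Let $\Omega(P,Q)=\sum_j\left(P_j\xi_j-Q_j\frac1i\frac{\partial}{\partial\xi_j}\right)$, so that for real $X=(P,Q)$ one has $(e^{i\Omega(X)}\psi)(\xi)=e^{i(P\cdot\xi-P\cdot Q/2)}\psi(\xi-Q)$. Let $\psi_A(\xi)=c\,e^{\frac i2\xi\cdot A\xi}$, where $c\ne0$ and $A$ is a complex symmetric matrix with positive definite imaginary part, and let $\psi_D=\int_{\mathcal L}d\mu(X)\,e^{i\Omega(X)}\psi_A$ be the corresponding Dirac wave function. Put $\langle\varphi,\psi\rangle=\int_{\mathcal L}d\mu(X)\,(\varphi,e^{i\Omega(X)}\psi)$ with $(\varphi,\psi)=\int\bar\varphi\psi\,d\xi$, and define (with $*$ the complex conjugation, $\perp\omega$ the skew-orthogonal complement in $\mathbb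 C^{2n}$) $$r=\{Y\in\mathbb C^{2n}:\Omega(Y)\psi_A=0\},\qquad \check r=\{Y\in(\mathcal L^{\mathbb C})^{\perp\omega}:\langle\Omega(Y)\psi_A,\Omega(Y)\psi_A\rangle=0\},$$ $$r_\perp=r\cap(\mathcal L^{\mathbb C})^{\perp\omega},\qquad r_-=\{Y\in r:\omega(Y,Y'^*)=0\ \text{for all } Y'\in r_\perp\}.$$ Then the following holds. 1. $\check r$ is a linear subspace containing $\mathcal L^{\mathbb C}$. The projections $C:r\to\mathbb C^n$ and $\check C:\check r\to\mathbb C^n$, $(P,Q)\mapsto Q$, are bijective. There are unique complex-linear maps $P_-:\mathcal L^{\mathbb C}\to r_-$ with $X=P_-X+(P_-X)^*$ for all $X\in\mathcal L$ (this map is bijective), $\Pi:\check r\to\mathcal L^{\mathbb C}$ with $Y-\Pi Y\in r_\perp$ for all $Y\in\check r$, and $\mathcal P_-:\check r\to r$ equal to the identity on $r_\perp$ and to $P_-$ on $\mathcal L^{\mathbb C}$. 2. $\psi_D$ is Gaussian, $\psi_D(\xi)=\check c\,e^{\frac i2\xi\cdot\check A\xi}$, both pointwise (the integral over $\mathcal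 L$ converges absolutely for each $\xi\in\mathbb R^n$) and as a distribution on Schwartz functions. With $\check B:\check r\to\mathbb C^n$, $(P,Q)\mapsto P$, one has $\check A=\check B\check C^{-1}$. 3. The constant is $$\check c=c\int_{\mathcal L}d\mu(X)\,e^{-\frac i2\omega(X,\,C^{-1}\check CX)}=c\,(2\pi)^{k/2}\,\frac{\sqrt{\det T}}{\Delta(P_-)},\qquad T=\Pi\,\check C^{-1}C\,\mathcal P_-\big|_{\mathcal L^{\mathbb C}}:\mathcal L^{\mathbb C}\to\mathcal L^{\mathbb C},$$ where the integral converges absolutely, all eigenvalues of $T$ have positive real part and $\sqrt{\det T}$ is the product of their principal square roots (with algebraic multiplicity). Here $\Delta(P_-)=|\det P_{ij}|\,J'/J$, where $P_{ij}$ is the matrix of $P_-$ in any real basis $e$ of $\mathcal L$ and any complex basis $f$ of $r_-$, $J$ is the $\mu$-measure of the parallelepiped spanned by $e$, and $J'=\sqrt{\det\left(\frac1i\omega(f_a,f_b^*)\right)}$, i.e. $r_-$ is measured by its inner product $\frac1i\omega(Y,Y'^*)$. -/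

import Mathlib

open MeasureTheory Complex Matrix
open scoped SchwartzMap

noncomputable section

namespace LinearConstraint

/-- The phase space of pairs `(P, Q)` of momenta and coordinates, over `𝕜 = ℝ` (the classical phase
space) or `𝕜 = ℂ` (its complexification). Complex conjugation is `star`. -/
abbrev Phase (𝕜 : Type) (n : ℕ) : Type := (Fin n → 𝕜) × (Fin n → 𝕜)

/-- The symplectic form `ω((P,Q),(P',Q')) = ∑ⱼ (Pⱼ Q'ⱼ - P'ⱼ Qⱼ)`. -/
def omega {𝕜 : Type} [CommRing 𝕜] {n : ℕ} (X Y : Phase 𝕜 n) : 𝕜 := X.1 ⬝ᵥ Y.2 - Y.1 ⬝ᵥ X.2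

/-- The inclusion of the real phase space into its complexification. -/
def toC {n : ℕ} (X : Phase ℝ n) : Phase ℂ n := (fun j => (X.1 j : ℂ), fun j => (X.2 j : ℂ))

/-- The complexification `L^ℂ` of a real subspace. -/
def complexify {n : ℕ} (L : Submodule ℝ (Phase ℝ n)) : Submodule ℂ (Phase ℂ n) :=
  Submodule.span ℂ (toC '' (L : Set (Phase ℝ n)))

/-- A real vector of `L`, as an element of `L^ℂ`. -/
def inC {n : ℕ} (L : Submodule ℝ (Phase ℝ n)) (X : L) : complexify L :=
  ⟨toC (X : Phase ℝ n), Submodule.subset_span ⟨_, X.2, rfl⟩⟩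

/-- The skew-orthogonal complement with respect to `ω`. -/
def skewOrth {n : ℕ} (S : Submodule ℂ (Phase ℂ n)) : Submodule ℂ (Phase ℂ n) where
  carrier := {Y | ∀ X ∈ S, omega Y X = 0}
  zero_mem' := fun X _ => by simp [omega]
  add_mem' := fun {Y Z} hY hZ X hX => by
    have h1 := hY X hX
    have h2 := hZ X hX
    simp only [omega, Prod.fst_add, Prod.snd_add, add_dotProduct, dotProduct_add] at *
    linear_combination h1 + h2
  smul_mem' := fun a Y hY X hX => by
    have h1 := hY X hX
    simp only [omega, Prod.smul_fst, Prod.smul_snd, smul_dotProduct, dotProduct_smul,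
      smul_eq_mul] at *
    linear_combination a * h1

/-- The operator `Ω(P,Q) = ∑ⱼ (Pⱼ ξⱼ - Qⱼ (1/i) ∂/∂ξⱼ)`, for complex `(P,Q)`. -/
def Omega {n : ℕ} (Y : Phase ℂ n) (ψ : (Fin n → ℝ) → ℂ) (ξ : Fin n → ℝ) : ℂ :=
  ∑ j, (Y.1 j * (ξ j : ℂ) * ψ ξ - Y.2 j * ((1 / I) * fderiv ℝ ψ ξ (Pi.single j 1)))

/-- The operator `e^{iΩ(X)}` for real `X = (P,Q)`, in its explicit form
`(e^{iΩ(X)} ψ)(ξ) = e^{i (P·ξ - P·Q/2)} ψ(ξ - Q)`. -/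
def expOmega {n : ℕ} (X : Phase ℝ n) (ψ : (Fin n → ℝ) → ℂ) (ξ : Fin n → ℝ) : ℂ :=
  exp (I * ((X.1 ⬝ᵥ ξ - X.1 ⬝ᵥ X.2 / 2 : ℝ) : ℂ)) * ψ (ξ - X.2)

/-- The Weyl relation `e^{iΩ(X)} e^{iΩ(X')} = e^{iΩ(X+X')} e^{(i/2) ω(X,X')}`. -/
theorem expOmega_expOmega {n : ℕ} (X X' : Phase ℝ n) (ψ : (Fin n → ℝ) → ℂ) (ξ : Fin n → ℝ) :
    expOmega X (expOmega X' ψ) ξ =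
      expOmega (X + X') ψ ξ * exp (I / 2 * ((omega X X' : ℝ) : ℂ)) := by
  have h : ξ - X.2 - X'.2 = ξ - (X + X').2 := by simp [sub_sub]
  have h2 : X.1 ⬝ᵥ X'.2 = X'.2 ⬝ᵥ X.1 := dotProduct_comm _ _
  simp only [expOmega, h]
  rw [← mul_assoc, ← exp_add, mul_right_comm, ← exp_add]
  congr 2
  simp only [omega, Prod.fst_add, Prod.snd_add, add_dotProduct, dotProduct_add, dotProduct_sub]
  push_cast
  ring

/-- `s ↦ e^{iΩ(sX)} ψ` solves `d/ds u = i Ω(X) u`: the generator of the group is `Ω(X)`. -/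
theorem hasDerivAt_expOmega {n : ℕ} (X : Phase ℝ n) {ψ : (Fin n → ℝ) → ℂ}
    (hψ : Differentiable ℝ ψ) (ξ : Fin n → ℝ) (s : ℝ) :
    HasDerivAt (fun t : ℝ => expOmega (t • X) ψ ξ)
      (I * Omega (toC X) (expOmega (s • X) ψ) ξ) s := by
  have hsum : ∀ F : (Fin n → ℝ) → ℂ, Omega (toC X) F ξ =
      ((X.1 ⬝ᵥ ξ : ℝ) : ℂ) * F ξ + I * fderiv ℝ F ξ X.2 := fun F => by
    have hQ : fderiv ℝ F ξ X.2 = ∑ j, (X.2 j : ℂ) * fderiv ℝ F ξ (Pi.single j 1) := by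
      conv_lhs => rw [pi_eq_sum_univ' X.2, map_sum]
      refine Finset.sum_congr rfl fun j _ => ?_
      rw [map_smul, real_smul]
    rw [hQ]
    simp only [Omega, toC, dotProduct, ofReal_sum, ofReal_mul, Finset.sum_mul, Finset.mul_sum,
      ← Finset.sum_add_distrib, one_div, inv_I]
    exact Finset.sum_congr rfl fun j _ => by ring
  have hdiff : Differentiable ℝ (expOmega (s • X) ψ) := by
    unfold expOmega dotProduct
    fun_prop
  have hline : ∀ a b : ℝ, HasDerivAt (fun t : ℝ => ψ (ξ - a • X.2 + (b * t) • X.2))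
      (fderiv ℝ ψ (ξ - a • X.2) (b • X.2)) 0 := fun a b => by
    have h1 : HasDerivAt (fun t : ℝ => ξ - a • X.2 + (b * t) • X.2) (b • X.2) 0 := by
      have h2 : HasDerivAt (fun t : ℝ => (b * t)) b 0 := by
        simpa using (hasDerivAt_id (0 : ℝ)).const_mul b
      exact (h2.smul_const X.2).const_add _
    have h3 : HasFDerivAt ψ (fderiv ℝ ψ (ξ - a • X.2)) (ξ - a • X.2 + (b * 0) • X.2) := by
      simpa using (hψ (ξ - a • X.2)).hasFDerivAt
    exact h3.comp_hasDerivAt (0 : ℝ) h1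
  have hfd : fderiv ℝ (expOmega (s • X) ψ) ξ X.2 =
      exp (I * ((s * (X.1 ⬝ᵥ ξ) - s * s * (X.1 ⬝ᵥ X.2) / 2 : ℝ) : ℂ)) *
        (I * ((s * (X.1 ⬝ᵥ X.2) : ℝ) : ℂ) * ψ (ξ - s • X.2) +
          fderiv ℝ ψ (ξ - s • X.2) X.2) := by
    rw [← (hdiff ξ).lineDeriv_eq_fderiv, lineDeriv]
    have he : HasDerivAt (fun t : ℝ => exp (I * ((s * (X.1 ⬝ᵥ ξ) - s * s * (X.1 ⬝ᵥ X.2) / 2 +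
        t * (s * (X.1 ⬝ᵥ X.2)) : ℝ) : ℂ))) (exp (I * ((s * (X.1 ⬝ᵥ ξ) - s * s * (X.1 ⬝ᵥ X.2) / 2 +
        0 * (s * (X.1 ⬝ᵥ X.2)) : ℝ) : ℂ)) * (I * ((1 * (s * (X.1 ⬝ᵥ X.2)) : ℝ) : ℂ))) 0 :=
      ((((hasDerivAt_id (0 : ℝ)).mul_const _).const_add _).ofReal_comp.const_mul I).cexp
    have hp := (he.mul (hline s 1)).deriv
    refine Eq.trans (congrArg (fun g => deriv g (0 : ℝ)) ?_) (hp.trans ?_)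
    · funext t
      simp only [expOmega, Pi.mul_apply]
      congr 1
      · congr 3
        simp only [Prod.smul_fst, Prod.smul_snd, smul_dotProduct, dotProduct_smul, dotProduct_add,
          smul_eq_mul]
        ring
      · congr 1
        simp only [Prod.smul_snd, one_mul]
        abel
    · simp
      ring
  have hs : HasDerivAt (fun t : ℝ => expOmega ((s + t) • X) ψ ξ)
      (exp (I * ((s * (X.1 ⬝ᵥ ξ) - s * s * (X.1 ⬝ᵥ X.2) / 2 : ℝ) : ℂ)) *
        (I * ((X.1 ⬝ᵥ ξ - s * (X.1 ⬝ᵥ X.2) : ℝ) : ℂ) * ψ (ξ - s • X.2) -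
          fderiv ℝ ψ (ξ - s • X.2) X.2)) 0 := by
    have hr : HasDerivAt (fun t : ℝ => (s + t) * (X.1 ⬝ᵥ ξ) - (s + t) * (s + t) * (X.1 ⬝ᵥ X.2) / 2)
        (X.1 ⬝ᵥ ξ - s * (X.1 ⬝ᵥ X.2)) 0 := by
      have h0 : HasDerivAt (fun t : ℝ => s + t) 1 0 := (hasDerivAt_id (0 : ℝ)).const_add s
      refine ((h0.mul_const (X.1 ⬝ᵥ ξ)).sub
        (((h0.mul h0).mul_const (X.1 ⬝ᵥ X.2)).div_const 2)).congr_deriv ?_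
      ring
    have hp := ((hr.ofReal_comp.const_mul I).cexp).mul (hline s (-1))
    refine (hp.congr_deriv ?_).congr_of_eventuallyEq (Filter.Eventually.of_forall fun t => ?_)
    · simp
      ring
    · simp only [expOmega, Pi.mul_apply]
      congr 1
      · congr 3
        simp only [Prod.smul_fst, Prod.smul_snd, smul_dotProduct, dotProduct_smul, smul_eq_mul]
        ring
      · congr 1
        simp only [add_smul, neg_mul, one_mul, neg_smul, Prod.snd_add, Prod.smul_snd]
        abel
  have hfin := HasDerivAt.comp_sub_const s s (by simpa using hs)
  refine (hfin.congr_deriv ?_).congr_of_eventuallyEq (Filter.Eventually.of_forall fun t => ?_)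
  · rw [hsum, hfd]
    simp only [expOmega, Prod.smul_fst, Prod.smul_snd, smul_dotProduct, dotProduct_smul,
      smul_eq_mul, ← mul_assoc]
    push_cast
    linear_combination (-(exp (I * (s * ((X.1 ⬝ᵥ ξ : ℝ) : ℂ) - s * s * ((X.1 ⬝ᵥ X.2 : ℝ) : ℂ) / 2)) *
      (I * (s * ((X.1 ⬝ᵥ X.2 : ℝ) : ℂ)) * ψ (ξ - s • X.2) + fderiv ℝ ψ (ξ - s • X.2) X.2))) * I_mul_I
  · simp

/-- The Gaussian wave function `c e^{(i/2) ∑ⱼₖ ξⱼ Aⱼₖ ξₖ}`. -/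
def gaussian {n : ℕ} (c : ℂ) (A : Matrix (Fin n) (Fin n) ℂ) (ξ : Fin n → ℝ) : ℂ :=
  c * exp (I / 2 * ∑ j, ∑ l, (ξ j : ℂ) * A j l * (ξ l : ℂ))

/-- The inner product `(φ, ψ) = ∫ φ̄ ψ dξ`. -/
def pairing {n : ℕ} (φ ψ : (Fin n → ℝ) → ℂ) : ℂ := ∫ ξ, star (φ ξ) * ψ ξ

/-- The inner product `⟨φ, ψ⟩ = ∫_L dμ(X) (φ, e^{iΩ(X)} ψ)` of the algebraic approach. -/
def constrInner {n : ℕ} (L : Submodule ℝ (Phase ℝ n)) (μ : Measure L)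
    (φ ψ : (Fin n → ℝ) → ℂ) : ℂ :=
  ∫ X : L, pairing φ (expOmega (X : Phase ℝ n) ψ) ∂μ

/-- The S-germ `r = {Y | Ω(Y) ψ = 0}`. -/
def sGerm {n : ℕ} (ψ : (Fin n → ℝ) → ℂ) : Submodule ℂ (Phase ℂ n) where
  carrier := {Y | ∀ ξ, Omega Y ψ ξ = 0}
  zero_mem' := fun ξ => by simp [Omega]
  add_mem' := fun {Y Z} hY hZ ξ => by
    have h : Omega (Y + Z) ψ ξ = Omega Y ψ ξ + Omega Z ψ ξ := by
      simp only [Omega, ← Finset.sum_add_distrib]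
      refine Finset.sum_congr rfl fun j _ => ?_
      simp only [Prod.fst_add, Prod.snd_add, Pi.add_apply]
      ring
    rw [h, hY ξ, hZ ξ, add_zero]
  smul_mem' := fun a Y hY ξ => by
    have h : Omega (a • Y) ψ ξ = a * Omega Y ψ ξ := by
      simp only [Omega, Finset.mul_sum]
      refine Finset.sum_congr rfl fun j _ => ?_
      simp only [Prod.smul_fst, Prod.smul_snd, Pi.smul_apply, smul_eq_mul]
      ring
    rw [h, hY ξ, mul_zero]

/-- The H-germ `ř`: the `Y` skew-orthogonal to `L` (these are the `Y` for which `Ω(Y)` acts on the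
physical Hilbert space) such that `Ω(Y) ψ` has norm zero for the inner product `⟨·,·⟩`. -/
def hGerm {n : ℕ} (L : Submodule ℝ (Phase ℝ n)) (μ : Measure L) (ψ : (Fin n → ℝ) → ℂ) :
    Set (Phase ℂ n) :=
  {Y | Y ∈ skewOrth (complexify L) ∧ constrInner L μ (Omega Y ψ) (Omega Y ψ) = 0}

/-- `r_⊥ = r ∩ (L^ℂ)^{⊥ω}`. -/
def rPerp {n : ℕ} (L : Submodule ℝ (Phase ℝ n)) (ψ : (Fin n → ℝ) → ℂ) :
    Submodule ℂ (Phase ℂ n) :=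
  sGerm ψ ⊓ skewOrth (complexify L)

/-- `r₋`, the orthogonal complement of `r_⊥` in `r` with respect to the Hermitian form
`(1/i) ω(Y, Y'^*)`. -/
def rMinus {n : ℕ} (L : Submodule ℝ (Phase ℝ n)) (ψ : (Fin n → ℝ) → ℂ) :
    Submodule ℂ (Phase ℂ n) where
  carrier := {Y | Y ∈ sGerm ψ ∧ ∀ Y' ∈ rPerp L ψ, omega Y (star Y') = 0}
  zero_mem' := ⟨Submodule.zero_mem _, fun X _ => by simp [omega]⟩
  add_mem' := fun {Y Z} hY hZ => ⟨Submodule.add_mem _ hY.1 hZ.1, fun X hX => by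
    have h1 := hY.2 X hX
    have h2 := hZ.2 X hX
    simp only [omega, Prod.fst_add, Prod.snd_add, add_dotProduct, dotProduct_add] at *
    linear_combination h1 + h2⟩
  smul_mem' := fun a Y hY => ⟨Submodule.smul_mem _ _ hY.1, fun X hX => by
    have h1 := hY.2 X hX
    simp only [omega, Prod.smul_fst, Prod.smul_snd, smul_dotProduct, dotProduct_smul,
      smul_eq_mul] at *
    linear_combination a * h1⟩

theorem rMinus_le {n : ℕ} (L : Submodule ℝ (Phase ℝ n)) (ψ : (Fin n → ℝ) → ℂ) :
    rMinus L ψ ≤ sGerm ψ := fun _ h => h.1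

/-- The projection `(P,Q) ↦ P` of a subspace to the momenta plane. -/
def projP {n : ℕ} (R : Submodule ℂ (Phase ℂ n)) : R →ₗ[ℂ] (Fin n → ℂ) :=
  (LinearMap.fst ℂ (Fin n → ℂ) (Fin n → ℂ)).domRestrict R

/-- The projection `(P,Q) ↦ Q` of a subspace to the coordinate plane. -/
def projQ {n : ℕ} (R : Submodule ℂ (Phase ℂ n)) : R →ₗ[ℂ] (Fin n → ℂ) :=
  (LinearMap.snd ℂ (Fin n → ℂ) (Fin n → ℂ)).domRestrict R

/-- The inverse of the (bijective) projection to the coordinate plane. -/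
def projQInv {n : ℕ} {R : Submodule ℂ (Phase ℂ n)} (h : Function.Bijective (projQ R)) :
    (Fin n → ℂ) →ₗ[ℂ] R :=
  (LinearEquiv.ofBijective (projQ R) h).symm.toLinearMap

/-- `P₋ : L^ℂ → r₋` is the complex-linear map with `X = P₋ X + (P₋ X)^*` for all real `X ∈ L`. -/
def IsPMinus {n : ℕ} {L : Submodule ℝ (Phase ℝ n)} {ψ : (Fin n → ℝ) → ℂ}
    (Pm : complexify L →ₗ[ℂ] rMinus L ψ) : Prop :=
  ∀ X : L, toC (X : Phase ℝ n) =
    (Pm (inC L X) : Phase ℂ n) + star (Pm (inC L X) : Phase ℂ n)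

/-- `Π : ř → L^ℂ` is the linear map with `Y - Π Y ∈ r_⊥`. -/
def IsPi {n : ℕ} (L : Submodule ℝ (Phase ℝ n)) (ψ : (Fin n → ℝ) → ℂ)
    {R : Submodule ℂ (Phase ℂ n)} (Pr : R →ₗ[ℂ] complexify L) : Prop :=
  ∀ Y : R, (Y : Phase ℂ n) - (Pr Y : Phase ℂ n) ∈ rPerp L ψ

/-- `𝒫₋ : ř → r` is the linear map that is the identity on `r_⊥` and `P₋` on `L^ℂ`. -/
def IsCalPMinus {n : ℕ} {L : Submodule ℝ (Phase ℝ n)} {ψ : (Fin n → ℝ) → ℂ}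
    {R : Submodule ℂ (Phase ℂ n)} (Pm : complexify L →ₗ[ℂ] rMinus L ψ)
    (PP : R →ₗ[ℂ] sGerm ψ) : Prop :=
  (∀ Y : R, (Y : Phase ℂ n) ∈ rPerp L ψ → (PP Y : Phase ℂ n) = Y) ∧
  (∀ (Y : R) (hY : (Y : Phase ℂ n) ∈ complexify L), (PP Y : Phase ℂ n) = Pm ⟨Y, hY⟩)

/-- The Jacobian `Δ(P₋) = |det P_{ij}| J' / J` computed in a real basis `e` of `L` and a complex
basis `f` of `r₋`. Here `dμ = J dx₁ ⋯ dx_k`, i.e. `J` is the measure of the parallelepiped spanned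
by `e`; `r₋` carries the density of the inner product `(1/i) ω(Y, Y'^*)`, i.e. `J'` is the square
root of the Gram determinant of `f` (`J' = 1` when `f` is orthonormal). -/
def jacobianMinus {n k : ℕ} {L : Submodule ℝ (Phase ℝ n)} (μ : Measure L)
    {ψ : (Fin n → ℝ) → ℂ} (Pm : complexify L →ₗ[ℂ] rMinus L ψ)
    (e : Module.Basis (Fin k) ℝ L) (f : Module.Basis (Fin k) ℂ (rMinus L ψ)) : ℝ :=
  ‖(Matrix.of fun a b => f.repr (Pm (inC L (e b))) a).det‖ *
    Real.sqrt ‖(Matrix.of fun a b =>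
      (1 / I) * omega (f a : Phase ℂ n) (star (f b : Phase ℂ n))).det‖ /
    (μ (parallelepiped e)).toReal

/-- The branch of `√(det T)` given by the product of the principal square roots of the
eigenvalues of `T`, counted with algebraic multiplicity. -/
def sqrtDet {V : Type} [AddCommGroup V] [Module ℂ V] [Module.Finite ℂ V]
    (T : V →ₗ[ℂ] V) : ℂ :=
  (T.charpoly.roots.map fun z => z ^ (1 / 2 : ℂ)).prod

end LinearConstraint

end

open LinearConstraint

/-! Everything becomes linear algebra on a Lagrangian graph plus one finite-dimensional Gaussian
integral with a carefully chosen branch.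

`Omega_gaussian` shows that Ω(P,Q) multiplies ψ_A by the linear form (P − AQ)·ξ, so r is the graph
of A. Symmetry of A makes r Lagrangian, and h(Y,Y') = (1/i) ω(Y,Y'^*) is positive definite on r,
with matrix 2 Im A. Hence ℂ^{2n} = r ⊕ r^*; `germProj` is the projection to r along r^*, and its
restriction to L^ℂ is P₋. Since L is isotropic, the Gram matrix B of the vectors P₋e_a, for a real
basis e of L, is real.

The H-germ. `pairing_gaussian_expOmega` gives (ψ_A, e^{iΩ(X)}ψ_A) = ‖ψ_A‖² e^{-h(P₋X,P₋X)/2}, on L a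
real Gaussian with matrix B. Decompose the r-component of Y^* as P₋Z + W with Z ∈ L^ℂ and W ∈ r_⊥.
Integration by parts over ξ and then over L cancels the contribution of Z, so that ⟨Ω(Y)ψ_A,
Ω(Y)ψ_A⟩ is a nonzero multiple of h(W,W). It vanishes exactly when W = 0, whence ř = L^ℂ + r_⊥
(`hGerm_eq`).

The Dirac function. In coordinates x on L the integrand is ψ_A(ξ) e^{-x·Mx/2 + ib·x} with M_{ab} = i
ω(e_a, C⁻¹Č e_b). Isotropy makes M symmetric, and injectivity of X ↦ Q makes Re M positive definite.
The square is completed by the map σ = Π Č⁻¹ of `exists_sub_snd_mem_rPerp`, which gives Ǎ; decay of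
the Gaussian and of the test function gives the distributional form by Fubini.

The constant. The identity M T = B (`diracMatrix_mul_toMatrix`) turns 1/√det M into √det T / √det B.
The eigenvalues of T are quotients of a positive number by a number in the right half-plane, so the
principal roots are continuous along the segment from B to M, and they give the correct branch
(`gaussConst_eq`). Finally √det B = J Δ(P₋) (`jacobianMinus_eq`). -/

noncomputable section

namespace LinearConstraint

/-! ### Quadratic forms and decay of complex Gaussians. -/

section Coordinates

variable {ι : Type}

/-- A real coordinate vector, regarded as a complex one. -/
def cvec (x : ι → ℝ) : ι → ℂ := fun j => (x j : ℂ)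

@[simp] theorem cvec_apply (x : ι → ℝ) (j : ι) : cvec x j = (x j : ℂ) := rfl

theorem cvec_add (x y : ι → ℝ) : cvec (x + y) = cvec x + cvec y := by ext; simp

theorem cvec_sub (x y : ι → ℝ) : cvec (x - y) = cvec x - cvec y := by ext; simp

theorem cvec_smul (a : ℝ) (x : ι → ℝ) : cvec (a • x) = (a : ℂ) • cvec x := by ext; simp

variable [Fintype ι]

theorem cvec_dotProduct (x y : ι → ℝ) : cvec x ⬝ᵥ cvec y = ((x ⬝ᵥ y : ℝ) : ℂ) := by
  simp [dotProduct]

theorem map_ofReal_mulVec_cvec (G : Matrix ι ι ℝ) (x : ι → ℝ) :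
    G.map ofReal *ᵥ cvec x = cvec (G *ᵥ x) := by
  ext; simp [mulVec, dotProduct]

theorem re_dotProduct_mulVec_cvec (S : Matrix ι ι ℂ) (x : ι → ℝ) :
    (cvec x ⬝ᵥ S *ᵥ cvec x).re = x ⬝ᵥ S.map re *ᵥ x := by
  simp [dotProduct, mulVec, Complex.re_sum]

theorem dotProduct_mulVec_comm {R : Type} [CommRing R] {S : Matrix ι ι R} (hS : S.IsSymm)
    (u v : ι → R) : u ⬝ᵥ S *ᵥ v = v ⬝ᵥ S *ᵥ u := by
  rw [dotProduct_mulVec, ← mulVec_transpose, hS.eq, dotProduct_comm]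

theorem dotProduct_mulVec_pos {R : Matrix ι ι ℝ} (hR : R.PosDef) {x : ι → ℝ} (hx : x ≠ 0) :
    0 < x ⬝ᵥ R *ᵥ x := by
  simpa using hR.dotProduct_mulVec_pos hx

/-- Two real symmetric matrices, one of which is positive definite, are diagonal in a common
basis. -/
theorem exists_congruence_diagonal [DecidableEq ι] {R K : Matrix ι ι ℝ} (hR : R.PosDef)
    (hK : K.IsSymm) :
    ∃ (G : Matrix ι ι ℝ) (d : ι → ℝ), IsUnit G.det ∧ Gᵀ * R * G = 1 ∧
      Gᵀ * K * G = diagonal d := by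
  have diag : ∀ {N : Matrix ι ι ℝ} (hN : N.IsHermitian), ∃ U : Matrix ι ι ℝ,
      Uᵀ * U = 1 ∧ Uᵀ * N * U = diagonal hN.eigenvalues := fun {N} hN => by
    refine ⟨hN.eigenvectorUnitary, ?_, ?_⟩
    · have := Unitary.coe_star_mul_self hN.eigenvectorUnitary
      rwa [star_eq_conjTranspose, conjTranspose_eq_transpose_of_trivial] at this
    · have := hN.conjStarAlgAut_star_eigenvectorUnitary
      rw [Unitary.conjStarAlgAut_star_apply, star_eq_conjTranspose,
        conjTranspose_eq_transpose_of_trivial] at this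
      simpa [Function.comp_def] using this
  obtain ⟨U, hU, hUR⟩ := diag hR.isHermitian
  -- Rescaling the eigenvectors turns R into the identity; a further orthogonal change diagonalizes
  -- K and preserves the identity.
  set W : Matrix ι ι ℝ := U * diagonal fun i => (Real.sqrt (hR.isHermitian.eigenvalues i))⁻¹
    with hW
  have hWR : Wᵀ * R * W = 1 := by
    have : Wᵀ * R * W = (diagonal fun i => (Real.sqrt (hR.isHermitian.eigenvalues i))⁻¹) *
        (Uᵀ * R * U) * diagonal fun i => (Real.sqrt (hR.isHermitian.eigenvalues i))⁻¹ := by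
      simp only [hW, transpose_mul, diagonal_transpose, Matrix.mul_assoc]
    rw [this, hUR, diagonal_mul_diagonal, diagonal_mul_diagonal, ← diagonal_one]
    congr 1
    ext i
    have hpos := hR.eigenvalues_pos i
    have := Real.mul_self_sqrt hpos.le
    have h0 := (Real.sqrt_pos.2 hpos).ne'
    field_simp
    linarith
  have hWK : (Wᵀ * K * W).IsHermitian := by
    rw [IsHermitian, conjTranspose_eq_transpose_of_trivial]
    simp only [transpose_mul, transpose_transpose, hK.eq, Matrix.mul_assoc]
  obtain ⟨V, hV, hVK⟩ := diag hWK
  have hG : (W * V)ᵀ * R * (W * V) = 1 := by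
    have : (W * V)ᵀ * R * (W * V) = Vᵀ * (Wᵀ * R * W) * V := by
      simp only [transpose_mul, Matrix.mul_assoc]
    rw [this, hWR, Matrix.mul_one, hV]
  refine ⟨W * V, hWK.eigenvalues, ?_, hG, ?_⟩
  · exact (isUnit_iff_isUnit_det _).1 (IsUnit.of_mul_eq_one_right _ hG)
  · rw [← hVK]
    simp only [transpose_mul, Matrix.mul_assoc]

/-- By homogeneity it suffices to take the minimum of the form over the compact unit sphere. -/
theorem exists_mul_norm_sq_le {R : Matrix ι ι ℝ} (hR : R.PosDef) :
    ∃ m > 0, ∀ x : ι → ℝ, m * ‖x‖ ^ 2 ≤ x ⬝ᵥ R *ᵥ x := by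
  have hc : Continuous fun x : ι → ℝ => x ⬝ᵥ R *ᵥ x := by
    unfold dotProduct mulVec dotProduct; fun_prop
  -- The unit sphere is empty when there are no coordinates.
  rcases (Metric.sphere (0 : ι → ℝ) 1).eq_empty_or_nonempty with h | h
  · refine ⟨1, one_pos, fun x => ?_⟩
    have hx : x = 0 := by
      by_contra hx
      have : (‖x‖⁻¹ • x) ∈ Metric.sphere (0 : ι → ℝ) 1 := by
        simp [norm_smul, norm_ne_zero_iff.2 hx]
      simp [h] at this
    simp [hx]
  · obtain ⟨y, hy, hmin⟩ := (isCompact_sphere (0 : ι → ℝ) 1).exists_isMinOn h hc.continuousOn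
    have hy1 : ‖y‖ = 1 := by simpa using hy
    refine ⟨y ⬝ᵥ R *ᵥ y, dotProduct_mulVec_pos hR (by rintro rfl; simp at hy1), fun x => ?_⟩
    by_cases hx : x = 0
    · simp [hx]
    have hn := norm_ne_zero_iff.2 hx
    have := hmin (a := ‖x‖⁻¹ • x) (by simp [norm_smul, hn])
    simp only [mulVec_smul, dotProduct_smul, smul_dotProduct, smul_eq_mul, Set.mem_ofPred_eq] at this
    calc _ ≤ (‖x‖⁻¹ * (‖x‖⁻¹ * (x ⬝ᵥ R *ᵥ x))) * ‖x‖ ^ 2 := by gcongr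
      _ = _ := by field_simp

/-- The Gaussian `e^{-½ x·Sx + i b·x}`. -/
def gaussExp (S : Matrix ι ι ℂ) (b : ι → ℂ) (x : ι → ℝ) : ℂ :=
  Complex.exp (-(1 / 2) * (cvec x ⬝ᵥ S *ᵥ cvec x) + I * (b ⬝ᵥ cvec x))

@[fun_prop]
theorem contDiff_gaussExp (S : Matrix ι ι ℂ) (b : ι → ℂ) : ContDiff ℝ 1 (gaussExp S b) := by
  unfold gaussExp dotProduct mulVec dotProduct cvec
  have : ∀ j, ContDiff ℝ 1 fun x : ι → ℝ => (x j : ℂ) := fun j =>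
    ofRealCLM.contDiff.comp (contDiff_apply ℝ ℝ j)
  fun_prop

@[fun_prop]
theorem continuous_gaussExp (S : Matrix ι ι ℂ) (b : ι → ℂ) : Continuous (gaussExp S b) :=
  (contDiff_gaussExp S b).continuous

theorem norm_gaussExp (S : Matrix ι ι ℂ) (b : ι → ℂ) (x : ι → ℝ) :
    ‖gaussExp S b x‖ = Real.exp (-(1 / 2) * (x ⬝ᵥ S.map re *ᵥ x) - (fun j => (b j).im) ⬝ᵥ x) := by
  rw [gaussExp, norm_exp, add_re, ← re_dotProduct_mulVec_cvec]
  congr 1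
  have h : (b ⬝ᵥ cvec x).im = (fun j => (b j).im) ⬝ᵥ x := by simp [dotProduct, Complex.im_sum]
  rw [← h, show (-(1 / 2) : ℂ) = ((-(1 / 2) : ℝ) : ℂ) by push_cast; rfl, re_ofReal_mul, I_mul_re]
  ring

theorem exists_abs_dotProduct_le (v : ι → ℝ) : ∃ M ≥ 0, ∀ x : ι → ℝ, |v ⬝ᵥ x| ≤ M * ‖x‖ := by
  refine ⟨∑ j, |v j|, by positivity, fun x => ?_⟩
  rw [dotProduct, Finset.sum_mul]
  refine (Finset.abs_sum_le_sum_abs _ _).trans (Finset.sum_le_sum fun j _ => ?_)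
  rw [abs_mul]
  gcongr
  exact norm_le_pi_norm x j

/-- A Gaussian decays faster than every power. -/
theorem exists_norm_gaussExp_le {S : Matrix ι ι ℂ} (hS : (S.map re).PosDef) (b : ι → ℂ) (N : ℕ) :
    ∃ C ≥ 0, ∀ x, (1 + ‖x‖) ^ N * ‖gaussExp S b x‖ ≤ C := by
  obtain ⟨m, hm, hle⟩ := exists_mul_norm_sq_le hS
  obtain ⟨M, hM, hb⟩ := exists_abs_dotProduct_le fun j => (b j).im
  -- The maximum over t of (M + N)t − mt²/2, where (1 + t)^N ≤ e^{Nt} absorbs the power.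
  refine ⟨Real.exp ((M + N) ^ 2 / (2 * m)), by positivity, fun x => ?_⟩
  have h1 : (1 + ‖x‖) ^ N ≤ Real.exp (N * ‖x‖) := by
    rw [Real.exp_nat_mul]
    gcongr
    linarith [Real.add_one_le_exp ‖x‖]
  rw [norm_gaussExp]
  refine (mul_le_mul_of_nonneg_right h1 (Real.exp_nonneg _)).trans ?_
  rw [← Real.exp_add, Real.exp_le_exp, le_div_iff₀ (by positivity)]
  have h2 := hle x
  have h3 := neg_le_of_abs_le (hb x)
  nlinarith [sq_nonneg (M + N - m * ‖x‖), norm_nonneg x]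

/-- The decay is used with `Fintype.card ι + 1` powers beyond the growth of f, which leaves an
integrable power of 1 + ‖x‖. -/
theorem integrable_mul_gaussExp {S : Matrix ι ι ℂ} (hS : (S.map re).PosDef) (b : ι → ℂ)
    {f : (ι → ℝ) → ℂ} (hf : f.HasTemperateGrowth) : Integrable fun x => f x * gaussExp S b x := by
  obtain ⟨k, C, hC, hle⟩ := hf.norm_iteratedFDeriv_le_uniform 0
  obtain ⟨C', hC', hle'⟩ := exists_norm_gaussExp_le hS b (k + (Fintype.card ι + 1))
  have hint : Integrable fun x : ι → ℝ => C * C' * (1 + ‖x‖) ^ (-((Fintype.card ι + 1 : ℕ) : ℝ)) :=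
    (integrable_one_add_norm (by simp)).const_mul _
  refine hint.mono' ?_ (Filter.Eventually.of_forall fun x => ?_)
  · exact (hf.1.continuous.mul (continuous_gaussExp S b)).aestronglyMeasurable
  have h1 := hle 0 le_rfl x
  rw [norm_iteratedFDeriv_zero] at h1
  have h0 : 0 < 1 + ‖x‖ := by positivity
  rw [norm_mul, Real.rpow_neg h0.le, Real.rpow_natCast, ← div_eq_mul_inv,
    le_div_iff₀ (by positivity)]
  calc ‖f x‖ * ‖gaussExp S b x‖ * (1 + ‖x‖) ^ (Fintype.card ι + 1)
      ≤ C * (1 + ‖x‖) ^ k * ‖gaussExp S b x‖ * (1 + ‖x‖) ^ (Fintype.card ι + 1) := by gcongr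
    _ = C * ((1 + ‖x‖) ^ (k + (Fintype.card ι + 1)) * ‖gaussExp S b x‖) := by ring
    _ ≤ C * C' := by gcongr; exact hle' x

theorem integrable_gaussExp {S : Matrix ι ι ℂ} (hS : (S.map re).PosDef) (b : ι → ℂ) :
    Integrable (gaussExp S b) := by
  simpa using integrable_mul_gaussExp hS b (Function.HasTemperateGrowth.const (1 : ℂ))

end Coordinates

/-! ### Complex Gaussian integrals and the branch of their square root. -/

section GaussianIntegral

variable {ι : Type}

theorem isSymm_map_ofReal {B : Matrix ι ι ℝ} (hB : B.PosDef) : (B.map ofReal).IsSymm := by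
  have : Bᵀ = B := by simpa using hB.isHermitian.eq
  rw [IsSymm, ← transpose_map, this]

theorem map_re_map_ofReal (B : Matrix ι ι ℝ) : (B.map ofReal).map re = B := by ext; simp

variable [Fintype ι]

/-- For v = x + iy the mixed terms cancel because S is symmetric, leaving x·Sx + y·Sy. -/
theorem re_star_dotProduct_mulVec_pos {S : Matrix ι ι ℂ} (hS : S.IsSymm)
    (hre : (S.map re).PosDef) {v : ι → ℂ} (hv : v ≠ 0) : 0 < (star v ⬝ᵥ S *ᵥ v).re := by
  set x : ι → ℝ := fun j => (v j).re
  set y : ι → ℝ := fun j => (v j).im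
  have hvxy : v = cvec x + I • cvec y := by
    ext j; simp [x, y, mul_comm I]
  have hstar : star v = cvec x - I • cvec y := by
    rw [hvxy]; ext j; simp [sub_eq_add_neg]
  have hexp : star v ⬝ᵥ S *ᵥ v = cvec x ⬝ᵥ S *ᵥ cvec x + cvec y ⬝ᵥ S *ᵥ cvec y := by
    rw [hstar, hvxy]
    simp only [mulVec_add, mulVec_smul, dotProduct_add, sub_dotProduct, dotProduct_smul,
      smul_dotProduct, smul_eq_mul]
    rw [dotProduct_mulVec_comm hS (cvec y) (cvec x)]
    linear_combination (-(cvec y ⬝ᵥ S *ᵥ cvec y)) * I_mul_I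
  rw [hexp, add_re, re_dotProduct_mulVec_cvec, re_dotProduct_mulVec_cvec]
  have hnn : ∀ u : ι → ℝ, 0 ≤ u ⬝ᵥ S.map re *ᵥ u := fun u => by
    by_cases hu : u = 0
    · simp [hu]
    · exact (dotProduct_mulVec_pos hre hu).le
  by_cases hx : x = 0
  · have hy : y ≠ 0 := by
      rintro hy
      exact hv (by rw [hvxy, hx, hy]; ext; simp)
    linarith [hnn x, dotProduct_mulVec_pos hre hy]
  · linarith [hnn y, dotProduct_mulVec_pos hre hx]

/-- The Gaussian integral `∫ e^{-½ x·Sx} dx`. -/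
def gaussConst (S : Matrix ι ι ℂ) : ℂ := ∫ x, gaussExp S 0 x

/-- The real exponent is a convex combination of its values at the ends, so the sum of the two end
integrands dominates. This continuity is what transports the branch of the square root. -/
theorem continuousOn_gaussConst_segment {S : Matrix ι ι ℂ} {B : Matrix ι ι ℝ}
    (hre : (S.map re).PosDef) (hB : B.PosDef) :
    ContinuousOn (fun t : ℝ => gaussConst ((1 - t : ℂ) • B.map ofReal + (t : ℂ) • S))
      (Set.Icc 0 1) := by
  have hreB : ((B.map ofReal).map re).PosDef := by rwa [map_re_map_ofReal]
  refine continuousOn_of_dominated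
    (bound := fun x => ‖gaussExp (B.map ofReal) 0 x‖ + ‖gaussExp S 0 x‖)
    (fun t _ => (continuous_gaussExp _ _).aestronglyMeasurable)
    (fun t ht => Filter.Eventually.of_forall fun x => ?_)
    ((integrable_gaussExp hreB 0).norm.add (integrable_gaussExp hre 0).norm)
    (Filter.Eventually.of_forall fun x => ?_)
  · simp only [norm_gaussExp]
    have hmap : (((1 - t : ℂ) • B.map ofReal + (t : ℂ) • S).map re) =
        (1 - t) • (B.map ofReal).map re + t • S.map re := by
      ext i j; simp
    rw [hmap, add_mulVec, smul_mulVec, smul_mulVec, dotProduct_add, dotProduct_smul,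
      dotProduct_smul]
    simp only [smul_eq_mul]
    set p := x ⬝ᵥ (B.map ofReal).map re *ᵥ x
    set q := x ⬝ᵥ S.map re *ᵥ x
    set l := (fun j => ((0 : ι → ℂ) j).im) ⬝ᵥ x
    rcases le_total p q with h | h
    · refine le_add_of_le_of_nonneg (Real.exp_le_exp.2 ?_) (Real.exp_nonneg _)
      nlinarith [mul_nonneg ht.1 (sub_nonneg.2 h)]
    · refine le_add_of_nonneg_of_le (Real.exp_nonneg _) (Real.exp_le_exp.2 ?_)
      nlinarith [mul_nonneg (sub_nonneg.2 ht.2) (sub_nonneg.2 h)]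
  · unfold gaussExp dotProduct mulVec dotProduct
    simp only [Matrix.add_apply, Matrix.smul_apply, smul_eq_mul]
    fun_prop

theorem fderiv_gaussExp (S : Matrix ι ι ℂ) (hS : S.IsSymm) (b : ι → ℂ) (x v : ι → ℝ) :
    fderiv ℝ (gaussExp S b) x v =
      (-(cvec v ⬝ᵥ S *ᵥ cvec x) + I * (b ⬝ᵥ cvec v)) * gaussExp S b x := by
  have hd : DifferentiableAt ℝ (gaussExp S b) x :=
    (contDiff_gaussExp S b).differentiable one_ne_zero x
  rw [← hd.lineDeriv_eq_fderiv, lineDeriv]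
  have hval : ∀ t : ℝ, gaussExp S b (x + t • v) = Complex.exp
      (-(1 / 2) * (cvec x ⬝ᵥ S *ᵥ cvec x) + I * (b ⬝ᵥ cvec x) +
        (t : ℂ) * (-(cvec v ⬝ᵥ S *ᵥ cvec x) + I * (b ⬝ᵥ cvec v)) +
        (t : ℂ) * (t : ℂ) * (-(1 / 2) * (cvec v ⬝ᵥ S *ᵥ cvec v))) := fun t => by
    rw [gaussExp]
    congr 1
    simp only [cvec_add, cvec_smul, mulVec_add, mulVec_smul, dotProduct_add, add_dotProduct,
      dotProduct_smul, smul_dotProduct, smul_eq_mul]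
    rw [dotProduct_mulVec_comm hS (cvec x) (cvec v)]
    ring
  have ht : HasDerivAt (fun t : ℝ => (t : ℂ)) 1 0 := by
    simpa using (hasDerivAt_id (0 : ℝ)).ofReal_comp
  have := (((ht.mul_const (-(cvec v ⬝ᵥ S *ᵥ cvec x) + I * (b ⬝ᵥ cvec v))).const_add
    (-(1 / 2) * (cvec x ⬝ᵥ S *ᵥ cvec x) + I * (b ⬝ᵥ cvec x))).add
    ((ht.mul ht).mul_const (-(1 / 2) * (cvec v ⬝ᵥ S *ᵥ cvec v)))).cexp.deriv
  refine (congrArg (fun f => deriv f (0 : ℝ)) (funext hval)).trans (this.trans ?_)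
  rw [gaussExp]
  simp
  ring

@[fun_prop]
theorem hasTemperateGrowth_dotProduct_cvec (w : ι → ℂ) :
    Function.HasTemperateGrowth fun x : ι → ℝ => w ⬝ᵥ cvec x := by
  unfold dotProduct cvec
  have : ∀ j, Function.HasTemperateGrowth fun x : ι → ℝ => (x j : ℂ) := fun j =>
    (ofRealCLM ∘L ContinuousLinearMap.proj (R := ℝ) (φ := fun _ : ι => ℝ) j).hasTemperateGrowth
  fun_prop

@[fun_prop]
theorem hasTemperateGrowth_dotProduct_mulVec_cvec (w : ι → ℂ) (S : Matrix ι ι ℂ) :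
    Function.HasTemperateGrowth fun x : ι → ℝ => w ⬝ᵥ S *ᵥ cvec x := by
  simp only [dotProduct_mulVec]
  fun_prop

variable [DecidableEq ι]

theorem integral_comp_mulVec {G : Matrix ι ι ℝ} (hG : G.det ≠ 0) {f : (ι → ℝ) → ℂ}
    (hf : Continuous f) : ∫ x, f x = |G.det| * ∫ y, f (G *ᵥ y) := by
  have h := Real.map_matrix_volume_pi_eq_smul_volume_pi hG
  have h2 : ∫ y, f (toLin' G y) = ∫ x, f x ∂(Measure.map (toLin' G) volume) :=
    (integral_map (LinearMap.continuous_of_finiteDimensional _).aemeasurable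
      hf.aestronglyMeasurable).symm
  simp only [toLin'_apply] at h2
  rw [h2, h, integral_smul_measure, ENNReal.toReal_ofReal (abs_nonneg _), abs_inv, real_smul,
    ← mul_assoc, ← ofReal_mul, mul_inv_cancel₀ (abs_ne_zero.2 hG), ofReal_one, one_mul]

/-- Re S and Im S are diagonalized simultaneously by a real congruence; reality of G keeps the
substitution x = Gy inside real space. -/
theorem exists_diagonal_of_posDef_re {S : Matrix ι ι ℂ} (hS : S.IsSymm)
    (hre : (S.map re).PosDef) :
    ∃ (G : Matrix ι ι ℝ) (δ : ι → ℂ), IsUnit G.det ∧ (∀ j, 0 < (δ j).re) ∧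
      (G.map ofReal)ᵀ * S * G.map ofReal = diagonal δ := by
  have hK : (S.map im).IsSymm := by
    rw [IsSymm, ← transpose_map, hS.eq]
  obtain ⟨G, d, hG, h1, h2⟩ := exists_congruence_diagonal hre hK
  -- Re S becomes the identity and Im S becomes diag(d).
  refine ⟨G, fun j => 1 + I * d j, hG, fun j => by simp, ?_⟩
  have hdec : S = (S.map re).map ofReal + I • (S.map im).map ofReal := by
    ext i j
    simp only [Matrix.add_apply, Matrix.smul_apply, map_apply, smul_eq_mul]
    rw [mul_comm]
    exact (re_add_im _).symm
  have hm : ∀ N : Matrix ι ι ℝ, (G.map ofReal)ᵀ * N.map ofReal * G.map ofReal =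
      (Gᵀ * N * G).map ofReal := fun N => by
    rw [← transpose_map]
    erw [Matrix.map_mul (f := ofRealHom), Matrix.map_mul (f := ofRealHom)]
    rfl
  conv_lhs => rw [hdec]
  rw [Matrix.mul_add, Matrix.add_mul, mul_smul_comm, Matrix.smul_mul, hm, hm, h1, h2]
  ext i j
  by_cases hij : i = j
  · subst hij; simp
  · simp [hij]

theorem gaussExp_mulVec {S : Matrix ι ι ℂ} {G : Matrix ι ι ℝ} {δ : ι → ℂ}
    (h : (G.map ofReal)ᵀ * S * G.map ofReal = diagonal δ) (b : ι → ℂ) (y : ι → ℝ) :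
    gaussExp S b (G *ᵥ y) = Complex.exp (-∑ j, δ j / 2 * (y j : ℂ) ^ 2 +
      ∑ j, I * (b ᵥ* G.map ofReal) j * y j) := by
  have h1 : cvec (G *ᵥ y) ⬝ᵥ S *ᵥ cvec (G *ᵥ y) = ∑ j, δ j * (y j : ℂ) ^ 2 := by
    rw [← map_ofReal_mulVec_cvec, mulVec_mulVec, dotProduct_mulVec, dotProduct_comm, ← mulVec_transpose,
      mulVec_mulVec, transpose_mul, Matrix.mul_assoc, ← transpose_transpose (Sᵀ * G.map ofReal),
      transpose_mul, transpose_transpose, ← transpose_mul, h, diagonal_transpose, dotProduct]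
    exact Finset.sum_congr rfl fun j _ => by simp [mulVec_diagonal]; ring
  have h2 : b ⬝ᵥ cvec (G *ᵥ y) = ∑ j, (b ᵥ* G.map ofReal) j * y j := by
    rw [← map_ofReal_mulVec_cvec, dotProduct_mulVec]; rfl
  rw [gaussExp, h1, h2]
  congr 2
  · rw [neg_mul, Finset.mul_sum]
    exact congrArg _ (Finset.sum_congr rfl fun j _ => by ring)
  · rw [Finset.mul_sum]
    exact Finset.sum_congr rfl fun j _ => by ring

theorem integral_gaussExp_of_diagonal {S : Matrix ι ι ℂ} {G : Matrix ι ι ℝ} {δ : ι → ℂ}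
    (hG : IsUnit G.det) (hδ : ∀ j, 0 < (δ j).re)
    (h : (G.map ofReal)ᵀ * S * G.map ofReal = diagonal δ) (b : ι → ℂ) :
    ∫ x, gaussExp S b x = |G.det| * (∏ j, (2 * Real.pi / δ j) ^ (1 / 2 : ℂ)) *
      Complex.exp (-(1 / 2) * ∑ j, (b ᵥ* G.map ofReal) j ^ 2 / δ j) := by
  rw [integral_comp_mulVec hG.ne_zero (continuous_gaussExp S b)]
  simp only [gaussExp_mulVec h]
  rw [GaussianFourier.integral_cexp_neg_sum_mul_add (b := fun j => δ j / 2)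
    (fun j => by rw [show δ j / 2 = ((1 / 2 : ℝ) : ℂ) * δ j by push_cast; ring, re_ofReal_mul]
                 have := hδ j; positivity)
    (fun j => I * (b ᵥ* G.map ofReal) j), Finset.prod_mul_distrib, ← Complex.exp_sum, mul_assoc]
  congr 3
  · ext j
    rw [div_div_eq_mul_div, mul_comm]
  · rw [Finset.mul_sum]
    refine Finset.sum_congr rfl fun j _ => ?_
    have : δ j ≠ 0 := fun h0 => by simpa [h0] using hδ j
    rw [mul_pow, I_sq]
    field_simp
    ring

/-- The Gaussian integral with a linear term, in terms of a solution of `S z = b`. -/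
theorem integral_gaussExp {S : Matrix ι ι ℂ} (hS : S.IsSymm) (hre : (S.map re).PosDef)
    {b z : ι → ℂ} (hz : S *ᵥ z = b) :
    ∫ x, gaussExp S b x = gaussConst S * Complex.exp (-(1 / 2) * (b ⬝ᵥ z)) := by
  obtain ⟨G, δ, hG, hδ, h⟩ := exists_diagonal_of_posDef_re hS hre
  rw [gaussConst, integral_gaussExp_of_diagonal hG hδ h, integral_gaussExp_of_diagonal hG hδ h]
  have hGc : IsUnit (G.map ofReal).det := by
    have : (G.map ofReal).det = ((G.det : ℝ) : ℂ) := (RingHom.map_det ofRealHom G).symm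
    rw [this]
    exact isUnit_iff_ne_zero.2 (ofReal_ne_zero.2 hG.ne_zero)
  -- In the diagonalizing coordinates S z = b reads δ_j w_j = (bG)_j, so the sum in the exponent is
  -- b·z.
  set w := (G.map ofReal)⁻¹ *ᵥ z with hw
  have hzw : z = G.map ofReal *ᵥ w := by
    rw [hw, mulVec_mulVec, mul_nonsing_inv _ hGc, one_mulVec]
  have hc : ∀ j, δ j * w j = (b ᵥ* G.map ofReal) j := fun j => by
    rw [← mulVec_transpose, ← hz, hzw, mulVec_mulVec, mulVec_mulVec, h,
      mulVec_diagonal]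
  have hsum : ∑ j, (b ᵥ* G.map ofReal) j ^ 2 / δ j = b ⬝ᵥ z := by
    rw [hzw, dotProduct_mulVec, dotProduct]
    refine Finset.sum_congr rfl fun j _ => ?_
    have : δ j ≠ 0 := fun h0 => by simpa [h0] using hδ j
    rw [← hc j]
    field_simp
  rw [hsum]
  simp

/-- Squaring removes the choice of roots, so the integral is determined up to sign; the sign is
settled by continuity in `gaussConst_eq`. -/
theorem gaussConst_sq_mul_det {S : Matrix ι ι ℂ} (hS : S.IsSymm) (hre : (S.map re).PosDef) :
    gaussConst S ^ 2 * S.det = (2 * Real.pi) ^ Fintype.card ι := by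
  obtain ⟨G, δ, hG, hδ, h⟩ := exists_diagonal_of_posDef_re hS hre
  have hδ0 : ∀ j, δ j ≠ 0 := fun j h0 => by simpa [h0] using hδ j
  have hdet : (G.det : ℂ) ^ 2 * S.det = ∏ j, δ j := by
    have : (G.map ofReal).det = ((G.det : ℝ) : ℂ) := (RingHom.map_det ofRealHom G).symm
    rw [← det_diagonal, ← h, det_mul, det_mul, det_transpose, this]
    ring
  have habs : ((|G.det| : ℝ) : ℂ) ^ 2 = (G.det : ℂ) ^ 2 := by
    rw [← ofReal_pow, sq_abs, ofReal_pow]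
  have hp : ∏ j, (2 * Real.pi / δ j : ℂ) * δ j = (2 * Real.pi) ^ Fintype.card ι := by
    rw [Finset.prod_congr rfl fun j _ => div_mul_cancel₀ _ (hδ0 j)]
    simp
  rw [gaussConst, integral_gaussExp_of_diagonal hG hδ h, mul_pow, mul_pow, habs,
    ← Finset.prod_pow, Finset.prod_congr rfl fun j _ => by
      rw [← cpow_nat_mul, show ((2 : ℕ) : ℂ) * (1 / 2) = 1 by norm_num, cpow_one]]
  simp only [zero_vecMul, Pi.zero_apply]
  rw [← hp, Finset.prod_mul_distrib, ← hdet]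
  simp
  ring

/-- For real B the integrand is positive, so the integral is the nonnegative root. This is the
starting point of the continuity argument. -/
theorem gaussConst_ofReal {B : Matrix ι ι ℝ} (hB : B.PosDef) :
    gaussConst (B.map ofReal) =
      (((2 * Real.pi) ^ ((Fintype.card ι : ℝ) / 2) / Real.sqrt B.det : ℝ) : ℂ) := by
  have hre := map_re_map_ofReal B
  have hsymm := isSymm_map_ofReal hB
  have hval : ∀ x, gaussExp (B.map ofReal) 0 x =
      ((Real.exp (-(1 / 2) * (x ⬝ᵥ B *ᵥ x)) : ℝ) : ℂ) := fun x => by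
    rw [gaussExp, map_ofReal_mulVec_cvec, cvec_dotProduct]
    simp
  have hreal : gaussConst (B.map ofReal) = ((∫ x, Real.exp (-(1 / 2) * (x ⬝ᵥ B *ᵥ x)) : ℝ) : ℂ) := by
    rw [gaussConst]
    refine Eq.trans ?_ integral_ofReal
    exact integral_congr_ae (Filter.Eventually.of_forall hval)
  have hsq := gaussConst_sq_mul_det hsymm (hre.symm ▸ hB)
  have hdet : (B.map ofReal).det = ((B.det : ℝ) : ℂ) := (RingHom.map_det ofRealHom B).symm
  rw [hreal, hdet] at hsq
  rw [hreal]
  norm_cast at hsq ⊢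
  have hd := hB.det_pos
  have hpi : (0 : ℝ) ≤ 2 * Real.pi := by positivity
  rw [← pow_left_inj₀ (integral_nonneg fun x => (Real.exp_pos _).le) (by positivity)
    (two_ne_zero), div_pow, Real.sq_sqrt hd.le, eq_div_iff hd.ne', hsq, ← Real.rpow_natCast,
    ← Real.rpow_natCast, ← Real.rpow_mul hpi]
  congr 1
  push_cast
  ring

/-- An eigenvector v of τ gives v^*Bv = z v^*Sv. The left side is real and positive and v^*Sv has
positive real part, so z lies in the open right half-plane. -/
theorem re_pos_of_mem_roots_charpoly {S τ : Matrix ι ι ℂ} {B : Matrix ι ι ℝ} (hS : S.IsSymm)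
    (hre : (S.map re).PosDef) (hB : B.PosDef) (hτ : S * τ = B.map ofReal) {z : ℂ}
    (hz : z ∈ τ.charpoly.roots) : 0 < z.re := by
  have hBs := isSymm_map_ofReal hB
  have hroot := (Polynomial.mem_roots'.1 hz).2
  rw [Polynomial.IsRoot, eval_charpoly] at hroot
  obtain ⟨v, hv0, hv⟩ := exists_mulVec_eq_zero_iff.2 hroot
  have hvz : τ *ᵥ v = z • v := by
    rw [scalar_apply, ← smul_one_eq_diagonal, sub_mulVec, smul_mulVec, one_mulVec,
      sub_eq_zero] at hv
    exact hv.symm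
  have hrel : star v ⬝ᵥ B.map ofReal *ᵥ v = z * (star v ⬝ᵥ S *ᵥ v) := by
    rw [← hτ, ← mulVec_mulVec, hvz, mulVec_smul, dotProduct_smul, smul_eq_mul]
  have hreB := map_re_map_ofReal B
  have hBpos := re_star_dotProduct_mulVec_pos hBs (hreB.symm ▸ hB) hv0
  have hBim : (star v ⬝ᵥ B.map ofReal *ᵥ v).im = 0 := by
    have h : star (star v ⬝ᵥ B.map ofReal *ᵥ v) = star v ⬝ᵥ B.map ofReal *ᵥ v := by
      have hw : star (B.map ofReal *ᵥ v) = B.map ofReal *ᵥ star v := by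
        ext
        simp [mulVec, dotProduct]
      rw [← star_dotProduct, hw, dotProduct_comm, dotProduct_mulVec_comm hBs]
    exact conj_eq_iff_im.1 h
  have hSpos := re_star_dotProduct_mulVec_pos hS hre hv0
  rw [hrel] at hBpos hBim
  rw [mul_re] at hBpos
  rw [mul_im] at hBim
  set w := star v ⬝ᵥ S *ᵥ v
  by_contra hneg
  push Not at hneg
  have hzi : z.im = -(z.re * w.im) / w.re := by
    field_simp; linarith
  rw [hzi] at hBpos
  have : z.re * w.re - -(z.re * w.im) / w.re * w.im = z.re * (w.re ^ 2 + w.im ^ 2) / w.re := by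
    field_simp; ring
  rw [this] at hBpos
  have : z.re * (w.re ^ 2 + w.im ^ 2) / w.re ≤ 0 :=
    div_nonpos_of_nonpos_of_nonneg (mul_nonpos_of_nonpos_of_nonneg hneg (by positivity)) hSpos.le
  linarith

/-- This is the characteristic polynomial evaluated at −t/s, rescaled by a power of −s. -/
theorem det_smul_add_smul_one_eq_prod_roots (τ : Matrix ι ι ℂ) {s : ℂ} (hs : s ≠ 0) (t : ℂ) :
    (s • τ + t • (1 : Matrix ι ι ℂ)).det = (τ.charpoly.roots.map fun z => s * z + t).prod := by
  have hsplit : τ.charpoly = (τ.charpoly.roots.map fun z => Polynomial.X - Polynomial.C z).prod :=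
    (IsAlgClosed.splits τ.charpoly).eq_prod_roots_of_monic τ.charpoly_monic
  have hcard : Multiset.card τ.charpoly.roots = Fintype.card ι := by
    rw [← charpoly_natDegree_eq_dim τ]
    exact (Polynomial.splits_iff_card_roots.1 (IsAlgClosed.splits τ.charpoly))
  have h1 : s • τ + t • (1 : Matrix ι ι ℂ) = (-s) • (scalar ι (-t / s) - τ) := by
    rw [scalar_apply, ← smul_one_eq_diagonal, smul_sub, smul_smul,
      show -s * (-t / s) = t by field_simp]
    simp [add_comm]
  have h2 : (scalar ι (-t / s) - τ).det = (τ.charpoly.roots.map fun z => -t / s - z).prod := by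
    rw [← eval_charpoly]
    conv_lhs => rw [hsplit]
    rw [Polynomial.eval_multiset_prod, Multiset.map_map]
    simp
  have h3 : (τ.charpoly.roots.map fun z => s * z + t) =
      τ.charpoly.roots.map fun z => -s * (-t / s - z) :=
    Multiset.map_congr rfl fun z _ => by field_simp; ring
  rw [h1, det_smul, h2, h3, Multiset.prod_map_mul, Multiset.map_const', Multiset.prod_replicate,
    hcard]

theorem prod_map_cpow_half_sq (s : Multiset ℂ) :
    (s.map fun z => z ^ (1 / 2 : ℂ)).prod ^ 2 = s.prod := by
  rw [← Multiset.prod_map_pow]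
  conv_rhs => rw [← s.map_id']
  refine congrArg _ (Multiset.map_congr rfl fun z _ => ?_)
  rw [← cpow_nat_mul, show ((2 : ℕ) : ℂ) * (1 / 2) = 1 by norm_num, cpow_one]

/-- The branch of the square root in the Gaussian integral `∫ e^{-½ x·Sx} dx`: for every positive
definite real `B`, it is given by the principal square roots of the eigenvalues of `S⁻¹ B`. -/
theorem gaussConst_eq {S τ : Matrix ι ι ℂ} {B : Matrix ι ι ℝ} (hS : S.IsSymm)
    (hre : (S.map re).PosDef) (hB : B.PosDef) (hτ : S * τ = B.map ofReal) :
    gaussConst S = (((2 * Real.pi) ^ ((Fintype.card ι : ℝ) / 2) / Real.sqrt B.det : ℝ) : ℂ) *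
      (τ.charpoly.roots.map fun z => z ^ (1 / 2 : ℂ)).prod := by
  -- The path from B to S factors as (1 − t)B + tS = S((1 − t)τ + t). The numbers (1 − t)z + t stay
  -- in the right half-plane, where the principal root is continuous.
  set g : ℝ → ℂ := fun t =>
    (τ.charpoly.roots.map fun z => ((1 - t) * z + t : ℂ) ^ (1 / 2 : ℂ)).prod with hg
  set F : ℝ → ℂ := fun t => gaussConst ((1 - t : ℂ) • B.map ofReal + (t : ℂ) • S) with hF
  have hroots : ∀ z ∈ τ.charpoly.roots, 0 < z.re := fun z hz =>
    re_pos_of_mem_roots_charpoly hS hre hB hτ hz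
  have hgc : ContinuousOn g (Set.Icc 0 1) := by
    refine continuousOn_multiset_prod _ fun z hz => ?_
    refine ContinuousOn.cpow_const (by fun_prop) fun t ht => Or.inl ?_
    have := hroots z hz
    have h1 : ((1 - t) * z + t : ℂ).re = (1 - t) * z.re + t := by simp
    rw [h1]
    rcases ht.1.eq_or_lt with h | h
    · rw [← h]; linarith
    · nlinarith [mul_nonneg (sub_nonneg.2 ht.2) this.le]
  have hdet : ∀ t ∈ Set.Icc (0 : ℝ) 1,
      ((1 - t : ℂ) • B.map ofReal + (t : ℂ) • S).det = S.det * g t ^ 2 := fun t ht => by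
    have hgt : g t ^ 2 = (τ.charpoly.roots.map fun z => ((1 - t) * z + t : ℂ)).prod := by
      rw [← prod_map_cpow_half_sq, Multiset.map_map]
      rfl
    rw [hgt]
    -- The eigenvalue formula divides by 1 − t, so the endpoint is treated apart.
    by_cases h1 : t = 1
    · subst h1; simp
    · have h2 : (1 - t : ℂ) ≠ 0 := by
        rw [sub_ne_zero]; exact fun h => h1 (by exact_mod_cast h.symm)
      rw [← det_smul_add_smul_one_eq_prod_roots τ h2, ← det_mul, Matrix.mul_add, mul_smul_comm,
        hτ, mul_smul_comm, Matrix.mul_one]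
  have hBs := isSymm_map_ofReal hB
  have hsq : ∀ t ∈ Set.Icc (0 : ℝ) 1, (F t * g t) ^ 2 * S.det = (2 * Real.pi) ^ Fintype.card ι :=
      fun t ht => by
    have hs : ((1 - t : ℂ) • B.map ofReal + (t : ℂ) • S).IsSymm :=
      (hBs.smul _).add (hS.smul _)
    have hr : (((1 - t : ℂ) • B.map ofReal + (t : ℂ) • S).map re).PosDef := by
      have hmap : (((1 - t : ℂ) • B.map ofReal + (t : ℂ) • S).map re) =
          (1 - t) • B + t • S.map re := by
        ext i j; simp
      rw [hmap]
      rcases ht.1.eq_or_lt with h | h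
      · simpa [← h] using hB
      · exact PosDef.posSemidef_add (hB.posSemidef.smul (sub_nonneg.2 ht.2)) (hre.smul h)
    rw [← gaussConst_sq_mul_det hs hr, hdet t ht]
    ring
  have hSdet : S.det ≠ 0 := fun h0 => by
    have := gaussConst_sq_mul_det hS hre
    rw [h0, mul_zero] at this
    exact pow_ne_zero _ (by simp [Real.pi_ne_zero]) this.symm
  have hne : F 0 * g 0 ≠ 0 := fun h0 => by
    have := hsq 0 (by simp)
    rw [h0] at this
    simp only [ne_eq, OfNat.ofNat_ne_zero, not_false_eq_true, zero_pow, zero_mul] at this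
    exact pow_ne_zero _ (by simp [Real.pi_ne_zero]) this.symm
  -- The square of F g is constant and nonzero; a continuous function on an interval with this
  -- property is itself constant.
  have key : F 1 * g 1 = F 0 * g 0 :=
    isPreconnected_Icc.eq_of_sq_eq (f := fun t => F t * g t) (g := fun _ => F 0 * g 0)
      ((continuousOn_gaussConst_segment hre hB).mul hgc) continuousOn_const
      (fun t ht => mul_right_cancel₀ hSdet
        ((hsq t ht).trans (hsq 0 (by simp)).symm)) (fun _ => hne)
      (Set.left_mem_Icc.2 zero_le_one) rfl (Set.right_mem_Icc.2 zero_le_one)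
  have hg1 : g 1 = 1 := by simp [hg]
  have hg0 : g 0 = (τ.charpoly.roots.map fun z => z ^ (1 / 2 : ℂ)).prod := by simp [hg]
  have hF1 : F 1 = gaussConst S := by simp [hF]
  have hF0 : F 0 = gaussConst (B.map ofReal) := by simp [hF]
  rw [hg1, hg0, hF1, hF0, mul_one, gaussConst_ofReal hB] at key
  exact key

/-- Integration by parts against a Gaussian. -/
theorem integral_affine_mul_gaussExp {S : Matrix ι ι ℂ} (hS : S.IsSymm)
    (hre : (S.map re).PosDef) (b w u : ι → ℂ) (κ : ℂ) :
    ∫ x, (w ⬝ᵥ cvec x + κ) * (u ⬝ᵥ S *ᵥ cvec x - I * (b ⬝ᵥ u)) * gaussExp S b x =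
      (w ⬝ᵥ u) * ∫ x, gaussExp S b x := by
  have hcoord : ∀ v : ι → ℝ,
      ∫ x, (w ⬝ᵥ cvec x + κ) * (cvec v ⬝ᵥ S *ᵥ cvec x - I * (b ⬝ᵥ cvec v)) * gaussExp S b x =
        (w ⬝ᵥ cvec v) * ∫ x, gaussExp S b x := fun v => by
    have hT : Function.HasTemperateGrowth fun x : ι → ℝ => w ⬝ᵥ cvec x + κ := by fun_prop
    have hdf : Differentiable ℝ fun x : ι → ℝ => w ⬝ᵥ cvec x + κ :=
      hT.1.differentiable (by simp)
    have hf' : ∀ x, fderiv ℝ (fun x : ι → ℝ => w ⬝ᵥ cvec x + κ) x v = w ⬝ᵥ cvec v := fun x => by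
      rw [← (hdf x).lineDeriv_eq_fderiv, lineDeriv]
      have ht : HasDerivAt (fun t : ℝ => (t : ℂ)) 1 0 := by
        simpa using (hasDerivAt_id (0 : ℝ)).ofReal_comp
      have := ((ht.mul_const (w ⬝ᵥ cvec v)).const_add (w ⬝ᵥ cvec x + κ)).deriv
      rw [one_mul] at this
      rw [← this]
      congr 1
      ext t
      simp only [cvec_add, cvec_smul, dotProduct_add, dotProduct_smul, smul_eq_mul]
      ring
    -- Differentiating the Gaussian along v produces exactly minus the second factor of the
    -- integrand.
    have h1 := integral_mul_fderiv_eq_neg_fderiv_mul_of_integrable (μ := volume) (𝕜 := ℂ)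
      (f := fun x : ι → ℝ => w ⬝ᵥ cvec x + κ) (g := gaussExp S b) (v := v)
      (by simp only [hf']; exact (integrable_gaussExp hre b).const_mul _)
      (by simp only [fderiv_gaussExp S hS, ← mul_assoc]
          exact integrable_mul_gaussExp hre b (by fun_prop))
      (integrable_mul_gaussExp hre b hT)
      (fun x _ => hdf x) (fun x _ => (contDiff_gaussExp S b).differentiable one_ne_zero x)
    simp only [hf', fderiv_gaussExp S hS] at h1
    rw [integral_const_mul] at h1
    rw [← neg_inj, ← h1, ← integral_neg]
    congr 1
    ext x
    ring
  -- Derivatives exist only in real directions; a complex u follows by linearity.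
  have hu : u = ∑ j, u j • cvec (Pi.single j 1) := by
    ext i
    simp [Finset.sum_apply, Pi.single_apply, apply_ite ofReal]
  have hsum : ∀ x : ι → ℝ,
      (w ⬝ᵥ cvec x + κ) * (u ⬝ᵥ S *ᵥ cvec x - I * (b ⬝ᵥ u)) * gaussExp S b x =
      ∑ j, u j * ((w ⬝ᵥ cvec x + κ) * (cvec (Pi.single j 1) ⬝ᵥ S *ᵥ cvec x -
        I * (b ⬝ᵥ cvec (Pi.single j 1))) * gaussExp S b x) := fun x => by
    conv_lhs => rw [hu]
    simp only [sum_dotProduct, dotProduct_sum, smul_dotProduct, dotProduct_smul, smul_eq_mul,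
      Finset.mul_sum, Finset.sum_mul, ← Finset.sum_sub_distrib]
    exact Finset.sum_congr rfl fun j _ => by ring
  simp only [hsum]
  rw [integral_finsetSum _ fun j _ => (integrable_mul_gaussExp hre b (by fun_prop)).const_mul _]
  simp only [integral_const_mul, hcoord]
  conv_rhs => rw [hu]
  simp only [dotProduct_sum, dotProduct_smul, smul_eq_mul, Finset.sum_mul, mul_assoc]

end GaussianIntegral

/-! ### The symplectic form and complex conjugation. -/

section Symplectic

variable {n : ℕ}

section Omega

variable {𝕜 : Type} [CommRing 𝕜]

theorem omega_add_left (X Y Z : Phase 𝕜 n) : omega (X + Y) Z = omega X Z + omega Y Z := by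
  simp [omega, add_dotProduct, dotProduct_add]; ring

theorem omega_add_right (X Y Z : Phase 𝕜 n) : omega X (Y + Z) = omega X Y + omega X Z := by
  simp [omega, add_dotProduct, dotProduct_add]; ring

theorem omega_sub_left (X Y Z : Phase 𝕜 n) : omega (X - Y) Z = omega X Z - omega Y Z := by
  simp [omega, sub_dotProduct, dotProduct_sub]; ring

theorem omega_smul_left (a : 𝕜) (X Y : Phase 𝕜 n) : omega (a • X) Y = a * omega X Y := by
  simp [omega]; ring

theorem omega_smul_right (a : 𝕜) (X Y : Phase 𝕜 n) : omega X (a • Y) = a * omega X Y := by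
  simp [omega]; ring

theorem omega_swap (X Y : Phase 𝕜 n) : omega X Y = -omega Y X := by
  simp [omega]

@[simp] theorem omega_zero_left (X : Phase 𝕜 n) : omega 0 X = 0 := by simp [omega]

theorem omega_sum_left {κ : Type} (s : Finset κ) (f : κ → Phase 𝕜 n) (Y : Phase 𝕜 n) :
    omega (∑ i ∈ s, f i) Y = ∑ i ∈ s, omega (f i) Y :=
  map_sum (AddMonoidHom.mk' (fun X => omega X Y) fun X Z => omega_add_left X Z Y) f s

theorem omega_sum_right {κ : Type} (s : Finset κ) (f : κ → Phase 𝕜 n) (Y : Phase 𝕜 n) :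
    omega Y (∑ i ∈ s, f i) = ∑ i ∈ s, omega Y (f i) :=
  map_sum (AddMonoidHom.mk' (fun X => omega Y X) fun X Z => omega_add_right Y X Z) f s

end Omega

theorem omega_star_star (X Y : Phase ℂ n) : omega (star X) (star Y) = star (omega X Y) := by
  simp [omega, dotProduct]

theorem omega_star_right (X Y : Phase ℂ n) : omega X (star Y) = star (omega (star X) Y) := by
  rw [← omega_star_star, star_star]

theorem omega_toC (X Y : Phase ℝ n) : omega (toC X) (toC Y) = ((omega X Y : ℝ) : ℂ) := by
  simp [omega, toC, dotProduct]

theorem star_toC (X : Phase ℝ n) : star (toC X) = toC X := by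
  ext <;> simp [toC]

theorem toC_add (X Y : Phase ℝ n) : toC (X + Y) = toC X + toC Y := by
  ext <;> simp [toC]

theorem toC_smul (a : ℝ) (X : Phase ℝ n) : toC (a • X) = (a : ℂ) • toC X := by
  ext <;> simp [toC]

theorem toC_sum {κ : Type} (s : Finset κ) (f : κ → Phase ℝ n) :
    toC (∑ i ∈ s, f i) = ∑ i ∈ s, toC (f i) :=
  map_sum (AddMonoidHom.mk' toC toC_add) f s

theorem toC_eq_cvec (X : Phase ℝ n) : toC X = (cvec X.1, cvec X.2) := rfl

theorem toC_add_I_smul_eq_zero {X Y : Phase ℝ n} (h : toC X + I • toC Y = 0) : X = 0 ∧ Y = 0 := by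
  have h1 : ∀ j, (X.1 j : ℂ) + I * Y.1 j = 0 := fun j => congrFun (congrArg Prod.fst h) j
  have h2 : ∀ j, (X.2 j : ℂ) + I * Y.2 j = 0 := fun j => congrFun (congrArg Prod.snd h) j
  constructor <;> ext j
  · simpa using congrArg re (h1 j)
  · simpa using congrArg re (h2 j)
  · simpa using congrArg im (h1 j)
  · simpa using congrArg im (h2 j)

end Symplectic

/-! ### The complexification of L. -/

section Complexify

variable {n k : ℕ} {L : Submodule ℝ (Phase ℝ n)}

theorem mem_complexify_iff {Z : Phase ℂ n} :
    Z ∈ complexify L ↔ ∃ X ∈ L, ∃ Y ∈ L, Z = toC X + I • toC Y := by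
  constructor
  · intro h
    induction h using Submodule.span_induction with
    | mem x hx =>
      obtain ⟨X, hX, rfl⟩ := hx
      exact ⟨X, hX, 0, L.zero_mem, by ext <;> simp [toC]⟩
    | zero => exact ⟨0, L.zero_mem, 0, L.zero_mem, by ext <;> simp [toC]⟩
    | add x y _ _ hx hy =>
      obtain ⟨X, hX, Y, hY, rfl⟩ := hx
      obtain ⟨X', hX', Y', hY', rfl⟩ := hy
      refine ⟨X + X', L.add_mem hX hX', Y + Y', L.add_mem hY hY', ?_⟩
      rw [toC_add, toC_add]
      module
    | smul a x _ hx =>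
      obtain ⟨X, hX, Y, hY, rfl⟩ := hx
      refine ⟨a.re • X - a.im • Y, L.sub_mem (L.smul_mem _ hX) (L.smul_mem _ hY),
        a.re • Y + a.im • X, L.add_mem (L.smul_mem _ hY) (L.smul_mem _ hX), ?_⟩
      rw [sub_eq_add_neg, ← neg_smul, toC_add, toC_add]
      simp only [toC_smul]
      conv_lhs => rw [← re_add_im a]
      push_cast
      linear_combination (norm := module) ((a.im : ℂ) * I_mul_I) • toC Y
  · rintro ⟨X, hX, Y, hY, rfl⟩
    exact Submodule.add_mem _ (Submodule.subset_span ⟨X, hX, rfl⟩)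
      (Submodule.smul_mem _ _ (Submodule.subset_span ⟨Y, hY, rfl⟩))

theorem toC_mem_complexify {X : Phase ℝ n} (hX : X ∈ L) : toC X ∈ complexify L :=
  Submodule.subset_span ⟨X, hX, rfl⟩

theorem star_mem_complexify {Z : Phase ℂ n} (hZ : Z ∈ complexify L) : star Z ∈ complexify L := by
  obtain ⟨X, hX, Y, hY, rfl⟩ := mem_complexify_iff.1 hZ
  rw [star_add, star_smul, star_toC, star_toC]
  exact Submodule.add_mem _ (toC_mem_complexify hX) (Submodule.smul_mem _ _ (toC_mem_complexify hY))

theorem omega_eq_zero_of_mem_complexify (hiso : ∀ X ∈ L, ∀ Y ∈ L, omega X Y = 0)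
    {Z Z' : Phase ℂ n} (hZ : Z ∈ complexify L) (hZ' : Z' ∈ complexify L) : omega Z Z' = 0 := by
  obtain ⟨X, hX, Y, hY, rfl⟩ := mem_complexify_iff.1 hZ
  obtain ⟨X', hX', Y', hY', rfl⟩ := mem_complexify_iff.1 hZ'
  simp [omega_add_left, omega_add_right, omega_smul_left, omega_smul_right, omega_toC,
    hiso _ hX _ hX', hiso _ hX _ hY', hiso _ hY _ hX', hiso _ hY _ hY']

theorem eq_zero_of_mem_complexify_of_snd_eq_zero
    (hproj : Set.InjOn Prod.snd (L : Set (Phase ℝ n))) {Z : Phase ℂ n} (hZ : Z ∈ complexify L)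
    (h : Z.2 = 0) : Z = 0 := by
  obtain ⟨X, hX, Y, hY, rfl⟩ := mem_complexify_iff.1 hZ
  have h2 : ∀ j, (X.2 j : ℂ) + I * Y.2 j = 0 := fun j => congrFun h j
  have hX0 : X = 0 := hproj hX L.zero_mem (by ext j; simpa using congrArg re (h2 j))
  have hY0 : Y = 0 := hproj hY L.zero_mem (by ext j; simpa using congrArg im (h2 j))
  subst hX0 hY0
  ext <;> simp [toC]

theorem complexify_le_skewOrth (hiso : ∀ X ∈ L, ∀ Y ∈ L, omega X Y = 0) :
    complexify L ≤ skewOrth (complexify L) := fun _ hZ _ hX =>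
  omega_eq_zero_of_mem_complexify hiso hZ hX

theorem inC_sum_eq (e : Module.Basis (Fin k) ℝ L) (g : Fin k → ℂ) :
    ((∑ a, g a • inC L (e a) : complexify L) : Phase ℂ n) =
      toC (∑ a, (g a).re • (e a : Phase ℝ n)) + I • toC (∑ a, (g a).im • (e a : Phase ℝ n)) := by
  rw [toC_sum, toC_sum, Finset.smul_sum, ← Finset.sum_add_distrib, Submodule.coe_sum]
  refine Finset.sum_congr rfl fun a _ => ?_
  rw [toC_smul, toC_smul, smul_smul, ← add_smul, mul_comm I, re_add_im]
  rfl

/-- A real basis of `L` as a complex basis of `L^ℂ`. -/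
def complexBasis (e : Module.Basis (Fin k) ℝ L) : Module.Basis (Fin k) ℂ (complexify L) :=
  Module.Basis.mk (v := fun a => inC L (e a))
    (by
      rw [Fintype.linearIndependent_iff]
      intro g hg a
      have h0 := inC_sum_eq e g
      rw [hg] at h0
      obtain ⟨h1, h2⟩ := toC_add_I_smul_eq_zero h0.symm
      have hli := Fintype.linearIndependent_iff.1 e.linearIndependent
      have h1' : ∑ a, (g a).re • e a = 0 := Subtype.ext (by simpa using h1)
      have h2' : ∑ a, (g a).im • e a = 0 := Subtype.ext (by simpa using h2)
      exact Complex.ext (hli _ h1' a) (hli _ h2' a))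
    (by
      rintro ⟨Z, hZ⟩ -
      obtain ⟨X, hX, Y, hY, rfl⟩ := mem_complexify_iff.1 hZ
      rw [Submodule.mem_span_range_iff_exists_fun]
      refine ⟨fun a => ⟨e.repr ⟨X, hX⟩ a, e.repr ⟨Y, hY⟩ a⟩, Subtype.ext ?_⟩
      rw [inC_sum_eq]
      have h1 := congrArg (Subtype.val) (e.sum_repr ⟨X, hX⟩)
      have h2 := congrArg (Subtype.val) (e.sum_repr ⟨Y, hY⟩)
      simp only [Submodule.coe_sum, Submodule.coe_smul] at h1 h2
      simp only [h1, h2])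

@[simp] theorem complexBasis_apply (e : Module.Basis (Fin k) ℝ L) (a : Fin k) :
    complexBasis e a = inC L (e a) := by
  simp [complexBasis]

end Complexify

/-! ### The S-germ as a Lagrangian graph, and the splitting r ⊕ r^*. -/

section Germ

variable {n : ℕ} {A : Matrix (Fin n) (Fin n) ℂ}

theorem gaussian_eq (c : ℂ) (A : Matrix (Fin n) (Fin n) ℂ) (ξ : Fin n → ℝ) :
    gaussian c A ξ = c * gaussExp (-I • A) 0 ξ := by
  rw [gaussian, gaussExp]
  congr 2
  rw [smul_mulVec, dotProduct_smul, zero_dotProduct, smul_eq_mul]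
  have : ∑ j, ∑ l, (ξ j : ℂ) * A j l * (ξ l : ℂ) = cvec ξ ⬝ᵥ A *ᵥ cvec ξ := by
    simp [dotProduct, mulVec, Finset.mul_sum, mul_assoc]
  rw [this]
  ring

theorem map_re_neg_I_smul (A : Matrix (Fin n) (Fin n) ℂ) : (-I • A).map re = A.map im := by
  ext; simp

/-- The gradient of the Gaussian is iAξ times the Gaussian, so Ω(Y) acts on it as multiplication by
a linear form. -/
theorem Omega_gaussian (hA : A.IsSymm) (c : ℂ) (Y : Phase ℂ n) (ξ : Fin n → ℝ) :
    Omega Y (gaussian c A) ξ = ((Y.1 - A *ᵥ Y.2) ⬝ᵥ cvec ξ) * gaussian c A ξ := by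
  have hfun : gaussian c A = fun ξ => c * gaussExp (-I • A) 0 ξ := funext (gaussian_eq c A)
  have hd : ∀ j, fderiv ℝ (gaussian c A) ξ (Pi.single j 1) =
      I * (A *ᵥ cvec ξ) j * gaussian c A ξ := fun j => by
    have hdiff : DifferentiableAt ℝ (gaussExp (-I • A) 0) ξ :=
      (contDiff_gaussExp _ _).differentiable one_ne_zero ξ
    have hs : cvec (Pi.single j (1 : ℝ)) = Pi.single j 1 := by
      ext i; by_cases h : i = j
      · subst h; simp
      · simp [h]
    rw [hfun, fderiv_const_mul hdiff]
    simp only [_root_.smul_apply, fderiv_gaussExp _ (hA.smul (-I)), smul_eq_mul]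
    rw [hs, single_dotProduct, smul_mulVec]
    simp
    ring
  have hAY : (A *ᵥ Y.2) ⬝ᵥ cvec ξ = Y.2 ⬝ᵥ A *ᵥ cvec ξ := by
    rw [dotProduct_comm, dotProduct_mulVec_comm hA]
  rw [sub_dotProduct, hAY, Omega]
  simp only [hd, dotProduct, sub_mul, Finset.sum_mul, Finset.sum_sub_distrib, cvec_apply]
  congr 1
  refine Finset.sum_congr rfl fun j _ => ?_
  have := I_ne_zero
  field_simp

theorem gaussian_ne_zero {c : ℂ} (hc : c ≠ 0) (ξ : Fin n → ℝ) : gaussian c A ξ ≠ 0 :=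
  mul_ne_zero hc (Complex.exp_ne_zero _)

theorem mem_sGerm_iff (hA : A.IsSymm) {c : ℂ} (hc : c ≠ 0) {Y : Phase ℂ n} :
    Y ∈ sGerm (gaussian c A) ↔ Y.1 = A *ᵥ Y.2 := by
  have h : Y ∈ sGerm (gaussian c A) ↔ ∀ ξ, Omega Y (gaussian c A) ξ = 0 := Iff.rfl
  simp only [h, Omega_gaussian hA, mul_eq_zero, gaussian_ne_zero hc, or_false]
  refine ⟨fun h => sub_eq_zero.1 (funext fun j => ?_), fun h ξ => by simp [h]⟩
  have hs : cvec (Pi.single j (1 : ℝ)) = Pi.single j 1 := by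
    ext i; by_cases h : i = j
    · subst h; simp
    · simp [h]
  simpa [hs] using h (Pi.single j 1)

/-- The graph of `A`, as a parametrization by the coordinates. -/
def graphMap (A : Matrix (Fin n) (Fin n) ℂ) : (Fin n → ℂ) →ₗ[ℂ] Phase ℂ n :=
  A.mulVecLin.prod LinearMap.id

@[simp] theorem graphMap_fst (v : Fin n → ℂ) : (graphMap A v).1 = A *ᵥ v := rfl

@[simp] theorem graphMap_snd (v : Fin n → ℂ) : (graphMap A v).2 = v := rfl

theorem graphMap_mem_sGerm (hA : A.IsSymm) {c : ℂ} (hc : c ≠ 0) (v : Fin n → ℂ) :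
    graphMap A v ∈ sGerm (gaussian c A) := (mem_sGerm_iff hA hc).2 rfl

theorem graphMap_snd_of_mem_sGerm (hA : A.IsSymm) {c : ℂ} (hc : c ≠ 0) {Y : Phase ℂ n}
    (hY : Y ∈ sGerm (gaussian c A)) : graphMap A Y.2 = Y :=
  Prod.ext ((mem_sGerm_iff hA hc).1 hY).symm rfl

/-- The graph of a symmetric matrix is Lagrangian. -/
theorem omega_graphMap_graphMap (hA : A.IsSymm) (v w : Fin n → ℂ) :
    omega (graphMap A v) (graphMap A w) = 0 := by
  simp only [omega, graphMap_fst, graphMap_snd]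
  rw [dotProduct_comm, dotProduct_mulVec_comm hA, dotProduct_comm, sub_self]

/-- The imaginary part of `A`, as a complex matrix. -/
def imC (A : Matrix (Fin n) (Fin n) ℂ) : Matrix (Fin n) (Fin n) ℂ := (A.map im).map ofReal

theorem sub_map_star (A : Matrix (Fin n) (Fin n) ℂ) : A - A.map star = (2 * I) • imC A := by
  ext i j
  simp [imC, Complex.ext_iff]
  ring

theorem star_mulVec_eq (A : Matrix (Fin n) (Fin n) ℂ) (v : Fin n → ℂ) :
    star (A *ᵥ v) = A.map star *ᵥ star v := by
  ext; simp [mulVec, dotProduct]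

theorem imC_isSymm (hIm : (A.map im).PosDef) : (imC A).IsSymm := isSymm_map_ofReal hIm

/-- Conjugation replaces A by its conjugate, and A − Ā = 2i Im A; so (1/i)ω(Y,Y'^*) has matrix 2 Im
A on the graph. -/
theorem omega_graphMap_star (hA : A.IsSymm) (v w : Fin n → ℂ) :
    omega (graphMap A v) (star (graphMap A w)) = 2 * I * (v ⬝ᵥ imC A *ᵥ star w) := by
  have h : 2 * I * (v ⬝ᵥ imC A *ᵥ star w) = v ⬝ᵥ (A - A.map star) *ᵥ star w := by
    rw [sub_map_star, smul_mulVec, dotProduct_smul, smul_eq_mul]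
  rw [h, sub_mulVec, dotProduct_sub, ← star_mulVec_eq, dotProduct_mulVec_comm hA v]
  simp only [omega, Prod.fst_star, Prod.snd_star, graphMap_fst, graphMap_snd]
  rw [dotProduct_comm v, dotProduct_comm (A *ᵥ v)]

theorem re_graphMap_pos (hA : A.IsSymm) (hIm : (A.map im).PosDef) {v : Fin n → ℂ} (hv : v ≠ 0) :
    0 < ((1 / I) * omega (graphMap A v) (star (graphMap A v))).re := by
  have hre : ((imC A).map re).PosDef := by rwa [imC, map_re_map_ofReal]
  have h := re_star_dotProduct_mulVec_pos (imC_isSymm hIm) hre hv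
  rw [omega_graphMap_star hA, dotProduct_mulVec_comm (imC_isSymm hIm)]
  have hI : (1 / I) * (2 * I * (star v ⬝ᵥ imC A *ᵥ v)) =
      ((2 : ℝ) : ℂ) * (star v ⬝ᵥ imC A *ᵥ v) := by
    have := I_ne_zero
    push_cast
    field_simp
  rw [hI, re_ofReal_mul]
  positivity

/-- Definiteness of the Hermitian form on r, the source of the vanishing and uniqueness arguments
below. -/
theorem eq_zero_of_omega_star_self (hA : A.IsSymm) (hIm : (A.map im).PosDef) {c : ℂ}
    (hc : c ≠ 0) {Y : Phase ℂ n} (hY : Y ∈ sGerm (gaussian c A)) (h : omega Y (star Y) = 0) :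
    Y = 0 := by
  rw [← graphMap_snd_of_mem_sGerm hA hc hY] at h ⊢
  by_cases hv : Y.2 = 0
  · rw [hv, map_zero]
  · have := re_graphMap_pos hA hIm hv
    rw [h] at this
    simp at this

theorem det_imC_isUnit (hIm : (A.map im).PosDef) : IsUnit (imC A).det := by
  have : (imC A).det = (((A.map im).det : ℝ) : ℂ) := (RingHom.map_det ofRealHom _).symm
  rw [this]
  exact isUnit_iff_ne_zero.2 (ofReal_ne_zero.2 hIm.det_pos.ne')

/-- The projection of the complexified phase space to the graph of `A` along its complex
conjugate, in coordinates. -/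
def germCoord (A : Matrix (Fin n) (Fin n) ℂ) : Phase ℂ n →ₗ[ℂ] (Fin n → ℂ) :=
  (2 * I)⁻¹ • ((imC A)⁻¹.mulVecLin ∘ₗ
    (LinearMap.fst ℂ _ _ - (A.map star).mulVecLin ∘ₗ LinearMap.snd ℂ _ _))

/-- If Z = (Av + Āw, v + w), then P − ĀQ = (A − Ā)v = 2i (Im A)v; this equation determines the
coordinate v of the r-component. -/
theorem smul_imC_mulVec_germCoord (hIm : (A.map im).PosDef) (Z : Phase ℂ n) :
    (2 * I) • (imC A *ᵥ germCoord A Z) = Z.1 - A.map star *ᵥ Z.2 := by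
  have h2 : (2 * I : ℂ) ≠ 0 := by simp
  simp only [germCoord, LinearMap.smul_apply, LinearMap.comp_apply, mulVecLin_apply, mulVec_smul,
    mulVec_mulVec, mul_nonsing_inv _ (det_imC_isUnit hIm), one_mulVec, smul_smul,
    mul_inv_cancel₀ h2, one_smul]
  rfl

/-- The projection of the complexified phase space to the graph of `A` along its complex
conjugate. -/
def germProj (A : Matrix (Fin n) (Fin n) ℂ) : Phase ℂ n →ₗ[ℂ] Phase ℂ n :=
  graphMap A ∘ₗ germCoord A

theorem germProj_apply (Z : Phase ℂ n) : germProj A Z = graphMap A (germCoord A Z) := rfl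

theorem germProj_mem_sGerm (hA : A.IsSymm) {c : ℂ} (hc : c ≠ 0) (Z : Phase ℂ n) :
    germProj A Z ∈ sGerm (gaussian c A) := graphMap_mem_sGerm hA hc _

theorem imC_mulVec_injective (hIm : (A.map im).PosDef) {v w : Fin n → ℂ}
    (h : imC A *ᵥ v = imC A *ᵥ w) : v = w := by
  rw [← one_mulVec v, ← one_mulVec w, ← nonsing_inv_mul _ (det_imC_isUnit hIm), ← mulVec_mulVec, h,
    mulVec_mulVec]

theorem star_imC_mulVec (A : Matrix (Fin n) (Fin n) ℂ) (v : Fin n → ℂ) :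
    star (imC A *ᵥ v) = imC A *ᵥ star v := by
  ext; simp [imC, mulVec, dotProduct]

/-- The component of Z in r^* is the conjugate of the r-component of Z^*. For real Z this is X = P₋X
+ (P₋X)^*. -/
theorem germProj_add_star (hIm : (A.map im).PosDef) (Z : Phase ℂ n) :
    germProj A Z + star (germProj A (star Z)) = Z := by
  have h1 := smul_imC_mulVec_germCoord hIm Z
  have h2 := congrArg star (smul_imC_mulVec_germCoord hIm (star Z))
  have hA2 : (A.map star).map star = A := by ext; simp
  rw [star_smul, star_imC_mulVec, star_sub, star_mulVec_eq, hA2] at h2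
  simp only [Prod.fst_star, Prod.snd_star, star_star, star_mul', RCLike.star_def, conj_I,
    map_ofNat] at h2
  have hQ : germCoord A Z + star (germCoord A (star Z)) = Z.2 := by
    refine imC_mulVec_injective hIm ?_
    have h3 : (2 * I) • (imC A *ᵥ (germCoord A Z + star (germCoord A (star Z)))) =
        (2 * I) • (imC A *ᵥ Z.2) := by
      have h4 : (2 * I) • (imC A *ᵥ star (germCoord A (star Z))) = -(Z.1 - A *ᵥ Z.2) := by
        rw [← h2]
        module
      rw [mulVec_add, smul_add, h1, h4, ← smul_mulVec, ← sub_map_star, sub_mulVec]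
      abel
    exact smul_right_injective _ (by simp : (2 * I : ℂ) ≠ 0) h3
  refine Prod.ext ?_ hQ
  have h5 : A *ᵥ germCoord A Z = A.map star *ᵥ germCoord A Z + (Z.1 - A.map star *ᵥ Z.2) := by
    rw [← h1, ← smul_mulVec, ← sub_map_star, sub_mulVec]
    abel
  have h6 : star (A *ᵥ germCoord A (star Z)) = A.map star *ᵥ Z.2 - A.map star *ᵥ germCoord A Z := by
    rw [star_mulVec_eq, ← mulVec_sub, ← hQ]
    congr 1
    abel
  change A *ᵥ germCoord A Z + star (A *ᵥ germCoord A (star Z)) = Z.1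
  rw [h5, h6]
  abel

/-- If Y = −Y'^*, then Y^* also lies in the Lagrangian r, so ω(Y,Y^*) = 0 and definiteness applies.
Thus r and r^* meet only in 0. -/
theorem eq_zero_of_add_star_eq_zero (hA : A.IsSymm) (hIm : (A.map im).PosDef) {c : ℂ}
    (hc : c ≠ 0) {Y Y' : Phase ℂ n} (hY : Y ∈ sGerm (gaussian c A))
    (hY' : Y' ∈ sGerm (gaussian c A)) (h : Y + star Y' = 0) : Y = 0 := by
  refine eq_zero_of_omega_star_self hA hIm hc hY ?_
  have h1 : star Y' = -Y := by rw [eq_neg_iff_add_eq_zero, add_comm, h]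
  have h2 : star Y = -Y' := by rw [← star_star Y', h1, star_neg, neg_neg]
  rw [h2, ← neg_one_smul ℂ Y', omega_smul_right]
  rw [← graphMap_snd_of_mem_sGerm hA hc hY, ← graphMap_snd_of_mem_sGerm hA hc hY',
    omega_graphMap_graphMap hA, mul_zero]

end Germ

/-! ### The decomposition of r relative to L, and the Gram matrix. -/

section GermStructure

variable {n k : ℕ} {A : Matrix (Fin n) (Fin n) ℂ} {L : Submodule ℝ (Phase ℝ n)} {c : ℂ}

theorem omega_sGerm_sGerm (hA : A.IsSymm) (hc : c ≠ 0) {Y Y' : Phase ℂ n}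
    (hY : Y ∈ sGerm (gaussian c A)) (hY' : Y' ∈ sGerm (gaussian c A)) : omega Y Y' = 0 := by
  rw [← graphMap_snd_of_mem_sGerm hA hc hY, ← graphMap_snd_of_mem_sGerm hA hc hY',
    omega_graphMap_graphMap hA]

/-- A vector of the Lagrangian r pairs only with the r^*-component of Z. -/
theorem omega_germProj_star (hA : A.IsSymm) (hIm : (A.map im).PosDef) (hc : c ≠ 0)
    {Y Z : Phase ℂ n} (hY : Y ∈ sGerm (gaussian c A)) :
    omega Y (star (germProj A (star Z))) = omega Y Z := by
  conv_rhs => rw [← germProj_add_star hIm Z]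
  rw [omega_add_right, omega_sGerm_sGerm hA hc hY (germProj_mem_sGerm hA hc Z), zero_add]

theorem germProj_eq_self (hA : A.IsSymm) (hIm : (A.map im).PosDef) (hc : c ≠ 0)
    {Y : Phase ℂ n} (hY : Y ∈ sGerm (gaussian c A)) : germProj A Y = Y := by
  have h := germProj_add_star hIm Y
  have h0 : germProj A Y - Y + star (germProj A (star Y)) = 0 := by
    rw [sub_add_eq_add_sub, h, sub_self]
  exact sub_eq_zero.1 (eq_zero_of_add_star_eq_zero hA hIm hc
    (Submodule.sub_mem _ (germProj_mem_sGerm hA hc Y) hY) (germProj_mem_sGerm hA hc _) h0)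

theorem germProj_star_eq_zero (hA : A.IsSymm) (hIm : (A.map im).PosDef) (hc : c ≠ 0)
    {Y : Phase ℂ n} (hY : Y ∈ sGerm (gaussian c A)) : germProj A (star Y) = 0 := by
  have h := germProj_add_star hIm Y
  rw [germProj_eq_self hA hIm hc hY, add_eq_left] at h
  exact star_eq_zero.1 h

theorem germProj_mem_rMinus (hA : A.IsSymm) (hIm : (A.map im).PosDef) (hc : c ≠ 0)
    {Z : Phase ℂ n} (hZ : Z ∈ complexify L) : germProj A Z ∈ rMinus L (gaussian c A) := by
  refine ⟨germProj_mem_sGerm hA hc Z, fun Y' hY' => ?_⟩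
  rw [omega_star_right, omega_swap]
  have := omega_germProj_star hA hIm hc (Z := star Z) hY'.1
  rw [star_star] at this
  rw [this, hY'.2 _ (star_mem_complexify hZ), neg_zero, star_zero]

/-- Testing on Z^* gives h(P₋Z,P₋Z) = 0, so P₋Z = 0 and Z^* ∈ r. Isotropy then gives ω(Z^*,Z) = 0,
and definiteness gives Z = 0. -/
theorem eq_zero_of_omega_germProj (hA : A.IsSymm) (hIm : (A.map im).PosDef) (hc : c ≠ 0)
    (hiso : ∀ X ∈ L, ∀ Y ∈ L, omega X Y = 0) {Z : Phase ℂ n} (hZ : Z ∈ complexify L)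
    (h : ∀ X ∈ complexify L, omega (germProj A Z) X = 0) : Z = 0 := by
  have h1 : germProj A Z = 0 := by
    refine eq_zero_of_omega_star_self hA hIm hc (germProj_mem_sGerm hA hc Z) ?_
    have := omega_germProj_star hA hIm hc (Z := star Z) (germProj_mem_sGerm hA hc Z)
    rw [star_star] at this
    rw [this, h _ (star_mem_complexify hZ)]
  have h2 := germProj_add_star hIm Z
  rw [h1, zero_add] at h2
  have h3 : star Z = germProj A (star Z) := by
    rw [← star_star (germProj A (star Z)), h2]
  have h4 : germProj A (star Z) = 0 := by
    refine eq_zero_of_omega_star_self hA hIm hc (germProj_mem_sGerm hA hc _) ?_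
    rw [h2, ← h3, omega_eq_zero_of_mem_complexify hiso (star_mem_complexify hZ) hZ]
  rw [← h2, h4, star_zero]

theorem eq_zero_of_omega_graphMap_snd (hIm : (A.map im).PosDef)
    (hiso : ∀ X ∈ L, ∀ Y ∈ L, omega X Y = 0)
    (hproj : Set.InjOn Prod.snd (L : Set (Phase ℝ n))) (hA : A.IsSymm)
    {Z : Phase ℂ n} (hZ : Z ∈ complexify L)
    (h : ∀ X ∈ complexify L, omega (graphMap A Z.2) X = 0) : Z = 0 := by
  refine eq_zero_of_mem_complexify_of_snd_eq_zero hproj hZ ?_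
  by_contra hne
  have h1 := h _ (star_mem_complexify hZ)
  have h2 : star (omega (graphMap A Z.2) (star Z)) = 0 := by rw [h1, star_zero]
  have h3 := omega_eq_zero_of_mem_complexify hiso hZ (star_mem_complexify hZ)
  have hpos := re_graphMap_pos hA hIm hne
  -- With G = `graphMap A Z.2`, the difference G − Z has no coordinate part, so ω(G − Z, (G − Z)^*)
  -- = 0; expanding expresses ω(G,G^*) through `h1`, `h2`, `h3`.
  have h4 : omega (graphMap A Z.2) (star (graphMap A Z.2)) = 0 := by
    rw [← omega_star_star, star_star] at h2
    simp only [omega, Prod.fst_star, Prod.snd_star, graphMap_fst, graphMap_snd] at h1 h2 h3 ⊢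
    linear_combination h1 - h2 - h3
  rw [h4] at hpos
  simp at hpos

/-- A nondegenerate pairing between `L^ℂ` and the coordinates of the germ can be inverted. -/
theorem exists_inverse_pairing {F : complexify L →ₗ[ℂ] (Fin n → ℂ)}
    (hF : ∀ Z, (∀ X ∈ complexify L, omega (graphMap A (F Z)) X = 0) → Z = 0) :
    ∃ σ : (Fin n → ℂ) →ₗ[ℂ] complexify L, ∀ v, ∀ X ∈ complexify L,
      omega (graphMap A v - graphMap A (F (σ v))) X = 0 := by
  let pair : (Fin n → ℂ) →ₗ[ℂ] Module.Dual ℂ (complexify L) :=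
    LinearMap.mk₂ ℂ (fun v (X : complexify L) => omega (graphMap A v) X)
      (fun v w X => by rw [map_add, omega_add_left])
      (fun a v X => by rw [map_smul, omega_smul_left, smul_eq_mul])
      (fun v X Y => by rw [Submodule.coe_add, omega_add_right])
      (fun a v X => by rw [Submodule.coe_smul, omega_smul_right, smul_eq_mul])
  have hpair : ∀ v (X : complexify L), pair v X = omega (graphMap A v) X := fun _ _ => rfl
  have hinj : Function.Injective (pair ∘ₗ F) := by
    rw [injective_iff_map_eq_zero]
    intro Z hZ
    refine hF Z fun X hX => ?_
    have := LinearMap.congr_fun hZ ⟨X, hX⟩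
    simpa [hpair] using this
  -- L^ℂ and its dual have the same dimension, so injectivity is enough; σ is `pair` followed by the
  -- inverse.
  have hbij : Function.Bijective (pair ∘ₗ F) := ⟨hinj,
    (LinearMap.injective_iff_surjective_of_finrank_eq_finrank
      (Subspace.dual_finrank_eq (K := ℂ)).symm).1 hinj⟩
  refine ⟨(LinearEquiv.ofBijective _ hbij).symm.toLinearMap ∘ₗ pair, fun v X hX => ?_⟩
  have h := (LinearEquiv.ofBijective _ hbij).apply_symm_apply (pair v)
  have h2 := LinearMap.congr_fun h ⟨X, hX⟩
  rw [omega_sub_left, sub_eq_zero]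
  exact h2.symm

theorem graphMap_mem_rPerp_iff (hA : A.IsSymm) (hc : c ≠ 0) {v : Fin n → ℂ} :
    graphMap A v ∈ rPerp L (gaussian c A) ↔ ∀ X ∈ complexify L, omega (graphMap A v) X = 0 :=
  ⟨fun h => h.2, fun h => ⟨graphMap_mem_sGerm hA hc v, h⟩⟩

/-- The decomposition r = P₋(L^ℂ) + r_⊥, from inverting the pairing of P₋Z with L^ℂ. -/
theorem exists_germProj_sub_mem_rPerp (hA : A.IsSymm) (hIm : (A.map im).PosDef) (hc : c ≠ 0)
    (hiso : ∀ X ∈ L, ∀ Y ∈ L, omega X Y = 0) {Y : Phase ℂ n} (hY : Y ∈ sGerm (gaussian c A)) :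
    ∃ Z ∈ complexify L, Y - germProj A Z ∈ rPerp L (gaussian c A) := by
  obtain ⟨σ, hσ⟩ := exists_inverse_pairing (A := A) (L := L)
    (F := germCoord A ∘ₗ (complexify L).subtype) fun Z hZ =>
      Subtype.ext (eq_zero_of_omega_germProj hA hIm hc hiso Z.2 hZ)
  refine ⟨σ Y.2, (σ Y.2).2, Submodule.sub_mem _ hY (germProj_mem_sGerm hA hc _), ?_⟩
  have := hσ Y.2
  rwa [graphMap_snd_of_mem_sGerm hA hc hY] at this

theorem eq_zero_of_mem_rMinus_of_mem_rPerp (hA : A.IsSymm) (hIm : (A.map im).PosDef) (hc : c ≠ 0)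
    {Y : Phase ℂ n} (h : Y ∈ rMinus L (gaussian c A)) (h' : Y ∈ rPerp L (gaussian c A)) :
    Y = 0 :=
  eq_zero_of_omega_star_self hA hIm hc h.1 (h.2 Y h')

/-- The map σ is Π Č⁻¹, obtained before ř is known to be a subspace: it selects the element of L^ℂ
whose lift to r through its Q-part agrees with that of v modulo r_⊥. -/
theorem exists_sub_snd_mem_rPerp (hA : A.IsSymm) (hIm : (A.map im).PosDef) (hc : c ≠ 0)
    (hiso : ∀ X ∈ L, ∀ Y ∈ L, omega X Y = 0)
    (hproj : Set.InjOn Prod.snd (L : Set (Phase ℝ n))) :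
    ∃ σ : (Fin n → ℂ) →ₗ[ℂ] complexify L, ∀ v,
      graphMap A v - graphMap A (σ v : Phase ℂ n).2 ∈ rPerp L (gaussian c A) := by
  obtain ⟨σ, hσ⟩ := exists_inverse_pairing (A := A) (L := L)
    (F := projQ (complexify L)) fun Z hZ =>
      Subtype.ext (eq_zero_of_omega_graphMap_snd hIm hiso hproj hA Z.2 hZ)
  refine ⟨σ, fun v => ?_⟩
  rw [← map_sub, graphMap_mem_rPerp_iff hA hc]
  intro X hX
  rw [map_sub]
  exact hσ v X hX

theorem eq_zero_of_mem_complexify_of_mem_rPerp (hA : A.IsSymm) (hIm : (A.map im).PosDef)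
    (hiso : ∀ X ∈ L, ∀ Y ∈ L, omega X Y = 0)
    (hproj : Set.InjOn Prod.snd (L : Set (Phase ℝ n))) {Z : Phase ℂ n} (hZ : Z ∈ complexify L)
    (h : graphMap A Z.2 ∈ rPerp L (gaussian c A)) : Z = 0 :=
  eq_zero_of_omega_graphMap_snd hIm hiso hproj hA hZ h.2

/-- The Gram matrix of the components in the germ of a basis of `L`. -/
def gramMatrix (A : Matrix (Fin n) (Fin n) ℂ) (e : Module.Basis (Fin k) ℝ L) :
    Matrix (Fin k) (Fin k) ℝ :=
  Matrix.of fun a b => ((1 / I) * omega (germProj A (toC (e a))) (star (germProj A (toC (e b))))).re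

/-- In 0 = ω(e_a,e_b) the r–r and r^*–r^* terms vanish, and the two mixed terms say that the Gram
entry equals its conjugate. -/
theorem gramMatrix_map_ofReal (hA : A.IsSymm) (hIm : (A.map im).PosDef)
    (hiso : ∀ X ∈ L, ∀ Y ∈ L, omega X Y = 0) (e : Module.Basis (Fin k) ℝ L) :
    (gramMatrix A e).map ofReal = Matrix.of fun a b =>
      (1 / I) * omega (germProj A (toC (e a))) (star (germProj A (toC (e b)))) := by
  ext a b
  simp only [gramMatrix, map_apply, of_apply]
  refine conj_eq_iff_re.1 ?_
  have h := omega_toC (e a : Phase ℝ n) (e b)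
  rw [hiso _ (e a).2 _ (e b).2, ofReal_zero] at h
  have hdec : ∀ X : Phase ℝ n, toC X = germProj A (toC X) + star (germProj A (toC X)) := fun X => by
    conv_lhs => rw [← germProj_add_star hIm (toC X), star_toC]
  rw [hdec (e a), hdec (e b)] at h
  simp only [omega_add_left, omega_add_right, omega_star_star] at h
  rw [germProj_apply, germProj_apply, omega_graphMap_graphMap hA] at h
  rw [germProj_apply, germProj_apply, map_mul, ← RCLike.star_def,
    ← omega_star_star, star_star]
  rw [star_zero, zero_add, add_zero] at h
  simp only [one_div, inv_I, star_neg, RCLike.star_def, conj_I]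
  linear_combination I * h

theorem toC_equivFun_symm (e : Module.Basis (Fin k) ℝ L) (x : Fin k → ℝ) :
    toC (e.equivFun.symm x : Phase ℝ n) = ∑ a, (x a : ℂ) • toC (e a) := by
  rw [Module.Basis.equivFun_symm_apply, Submodule.coe_sum, toC_sum]
  exact Finset.sum_congr rfl fun a _ => toC_smul _ _

theorem omega_germProj_sum (hA : A.IsSymm) (hIm : (A.map im).PosDef)
    (hiso : ∀ X ∈ L, ∀ Y ∈ L, omega X Y = 0) (e : Module.Basis (Fin k) ℝ L) (z w : Fin k → ℂ) :
    (1 / I) * omega (germProj A (∑ a, z a • toC (e a)))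
      (star (germProj A (∑ a, w a • toC (e a)))) =
      z ⬝ᵥ (gramMatrix A e).map ofReal *ᵥ star w := by
  rw [gramMatrix_map_ofReal hA hIm hiso]
  simp only [map_sum, map_smul, star_sum, star_smul, omega_sum_left, omega_sum_right,
    omega_smul_left, omega_smul_right, dotProduct, mulVec, of_apply, Finset.mul_sum, Pi.star_apply]
  rw [Finset.sum_comm]
  exact Finset.sum_congr rfl fun a _ => Finset.sum_congr rfl fun b _ => by ring

/-- A nonzero real X has P₋X ≠ 0, because X = P₋X + (P₋X)^*. -/
theorem posDef_gramMatrix (hA : A.IsSymm) (hIm : (A.map im).PosDef)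
    (hiso : ∀ X ∈ L, ∀ Y ∈ L, omega X Y = 0) (e : Module.Basis (Fin k) ℝ L) :
    (gramMatrix A e).PosDef := by
  refine PosDef.of_dotProduct_mulVec_pos ?_ fun x hx => ?_
  · ext a b
    have h1 := congrFun (congrFun (gramMatrix_map_ofReal hA hIm hiso e) a) b
    have h2 := congrFun (congrFun (gramMatrix_map_ofReal hA hIm hiso e) b) a
    simp only [map_apply, of_apply] at h1 h2
    rw [conjTranspose_apply, star_trivial, ← ofReal_inj, h2, ← conj_ofReal, h1, map_mul,
      ← RCLike.star_def, ← omega_star_star, star_star, omega_swap]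
    simp
  · have hX : (e.equivFun.symm x : Phase ℝ n) ≠ 0 := by
      rw [Ne, Submodule.coe_eq_zero, LinearEquiv.map_eq_zero_iff]
      exact hx
    have hg : germProj A (toC (e.equivFun.symm x : Phase ℝ n)) ≠ 0 := fun h0 => hX <| by
      have h1 := germProj_add_star hIm (toC (e.equivFun.symm x : Phase ℝ n))
      rw [star_toC, h0, star_zero, add_zero] at h1
      exact (toC_add_I_smul_eq_zero (X := (e.equivFun.symm x : Phase ℝ n)) (Y := 0)
        (by rw [← h1]; ext <;> simp [toC])).1
    have hv : germCoord A (toC (e.equivFun.symm x : Phase ℝ n)) ≠ 0 := fun h0 => hg <| by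
      rw [germProj_apply, h0, map_zero]
    have hpos := re_graphMap_pos hA hIm hv
    rw [← germProj_apply, toC_equivFun_symm, omega_germProj_sum hA hIm hiso e] at hpos
    have hs : star (fun a => (x a : ℂ)) = fun a => (x a : ℂ) := by ext; simp
    rw [hs] at hpos
    change 0 < (cvec x ⬝ᵥ (gramMatrix A e).map ofReal *ᵥ cvec x).re at hpos
    rw [map_ofReal_mulVec_cvec, cvec_dotProduct, ofReal_re] at hpos
    simpa using hpos

end GermStructure

/-! ### Matrix elements of e^{iΩ(X)} between Gaussian states. -/

section Pairing

variable {n : ℕ} {A : Matrix (Fin n) (Fin n) ℂ}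

theorem gaussian_apply (c : ℂ) (A : Matrix (Fin n) (Fin n) ℂ) (ξ : Fin n → ℝ) :
    gaussian c A ξ = c * Complex.exp (I / 2 * (cvec ξ ⬝ᵥ A *ᵥ cvec ξ)) := by
  rw [gaussian]
  congr 3
  simp [dotProduct, mulVec, Finset.mul_sum, mul_assoc]

theorem expOmega_gaussian (hA : A.IsSymm) (c : ℂ) (X : Phase ℝ n) (ξ : Fin n → ℝ) :
    expOmega X (gaussian c A) ξ = gaussian c A ξ * Complex.exp
      (I * ((cvec X.1 - A *ᵥ cvec X.2) ⬝ᵥ cvec ξ) +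
        I / 2 * (cvec X.2 ⬝ᵥ A *ᵥ cvec X.2 - cvec X.1 ⬝ᵥ cvec X.2)) := by
  rw [expOmega, gaussian_apply, gaussian_apply, mul_left_comm, mul_assoc, ← Complex.exp_add,
    ← Complex.exp_add]
  congr 2
  have h1 : A *ᵥ cvec X.2 ⬝ᵥ cvec ξ = cvec X.2 ⬝ᵥ A *ᵥ cvec ξ := by
    rw [dotProduct_comm, dotProduct_mulVec_comm hA]
  simp only [cvec_sub, mulVec_sub, dotProduct_sub, sub_dotProduct, h1]
  rw [dotProduct_mulVec_comm hA (cvec ξ) (cvec X.2), cvec_dotProduct, cvec_dotProduct]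
  push_cast
  ring

theorem two_smul_imC (A : Matrix (Fin n) (Fin n) ℂ) :
    (2 : ℂ) • imC A = (-I) • (A - A.map star) := by
  rw [sub_map_star, smul_smul]
  congr 1
  linear_combination (2 : ℂ) * I_mul_I

theorem star_gaussian_mul_expOmega (hA : A.IsSymm) (c : ℂ) (X : Phase ℝ n) (ξ : Fin n → ℝ) :
    star (gaussian c A ξ) * expOmega X (gaussian c A) ξ = star c * c * Complex.exp
      (I / 2 * (cvec X.2 ⬝ᵥ A *ᵥ cvec X.2 - cvec X.1 ⬝ᵥ cvec X.2)) *
        gaussExp ((2 : ℂ) • imC A) (cvec X.1 - A *ᵥ cvec X.2) ξ := by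
  have hstar : star (gaussian c A ξ) =
      star c * Complex.exp (-(I / 2) * (cvec ξ ⬝ᵥ A.map star *ᵥ cvec ξ)) := by
    have h : star (cvec ξ ⬝ᵥ A *ᵥ cvec ξ) = cvec ξ ⬝ᵥ A.map star *ᵥ cvec ξ := by
      simp [dotProduct, mulVec]
    rw [gaussian_apply, star_mul', ← h]
    simp only [RCLike.star_def, ← Complex.exp_conj, map_mul, map_div₀, conj_I, map_ofNat, neg_div]
  rw [expOmega_gaussian hA, hstar, gaussian_apply, gaussExp, two_smul_imC, smul_mulVec, sub_mulVec,
    dotProduct_smul, dotProduct_sub, smul_eq_mul]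
  set a := cvec ξ ⬝ᵥ A *ᵥ cvec ξ
  set a' := cvec ξ ⬝ᵥ A.map star *ᵥ cvec ξ
  set p := (cvec X.1 - A *ᵥ cvec X.2) ⬝ᵥ cvec ξ
  set q := cvec X.2 ⬝ᵥ A *ᵥ cvec X.2 - cvec X.1 ⬝ᵥ cvec X.2
  have h : Complex.exp (-(I / 2) * a') * (Complex.exp (I / 2 * a) * Complex.exp (I * p + I / 2 * q)) =
      Complex.exp (I / 2 * q) * Complex.exp (-(1 / 2) * (-I * (a - a')) + I * p) := by
    rw [← Complex.exp_add, ← Complex.exp_add, ← Complex.exp_add]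
    congr 1
    ring
  linear_combination (star c * c) * h

theorem isSymm_two_smul_imC (hIm : (A.map im).PosDef) : ((2 : ℂ) • imC A).IsSymm :=
  (imC_isSymm hIm).smul _

theorem posDef_two_smul_imC (hIm : (A.map im).PosDef) : (((2 : ℂ) • imC A).map re).PosDef := by
  have : ((2 : ℂ) • imC A).map re = (2 : ℝ) • A.map im := by
    ext; simp [imC]
  rw [this]
  exact hIm.smul two_pos

theorem germCoord_toC_add_star (hIm : (A.map im).PosDef) (X : Phase ℝ n) :
    germCoord A (toC X) + star (germCoord A (toC X)) = cvec X.2 := by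
  have := congrArg Prod.snd (germProj_add_star hIm (toC X))
  rwa [star_toC] at this

theorem two_smul_imC_mulVec_germCoord (hIm : (A.map im).PosDef) (Z : Phase ℂ n) :
    ((2 : ℂ) • imC A) *ᵥ germCoord A Z = (-I) • (Z.1 - A.map star *ᵥ Z.2) := by
  rw [← smul_imC_mulVec_germCoord hIm, smul_mulVec, smul_smul]
  congr 1
  linear_combination (2 : ℂ) * I_mul_I

theorem two_smul_imC_mulVec_star_germCoord (hIm : (A.map im).PosDef) (Z : Phase ℂ n) :
    ((2 : ℂ) • imC A) *ᵥ star (germCoord A Z) = I • (star Z.1 - A *ᵥ star Z.2) := by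
  have hA2 : (A.map star).map star = A := by ext; simp
  have := congrArg star (two_smul_imC_mulVec_germCoord hIm Z)
  rw [smul_mulVec, star_smul, star_imC_mulVec, star_smul, star_sub, star_mulVec_eq, hA2] at this
  rw [smul_mulVec]
  simpa using this

theorem omega_graphMap_star_self (hA : A.IsSymm) (v : Fin n → ℂ) :
    (1 / I) * omega (graphMap A v) (star (graphMap A v)) =
      v ⬝ᵥ ((2 : ℂ) • imC A) *ᵥ star v := by
  rw [omega_graphMap_star hA, smul_mulVec, dotProduct_smul, smul_eq_mul]
  have := I_ne_zero
  field_simp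

theorem star_cvec (x : Fin n → ℝ) : star (cvec x) = cvec x := by ext; simp

/-- The squared norm of a Gaussian state. -/
def gaussNormSq (c : ℂ) (A : Matrix (Fin n) (Fin n) ℂ) : ℂ :=
  star c * c * gaussConst ((2 : ℂ) • imC A)

theorem gaussNormSq_ne_zero {c : ℂ} (hc : c ≠ 0) (hIm : (A.map im).PosDef) :
    gaussNormSq c A ≠ 0 := by
  refine mul_ne_zero (mul_ne_zero (star_ne_zero.2 hc) hc) fun h => ?_
  have := gaussConst_sq_mul_det (isSymm_two_smul_imC hIm) (posDef_two_smul_imC hIm)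
  rw [h, zero_pow two_ne_zero, zero_mul] at this
  exact pow_ne_zero _ (by simp [Real.pi_ne_zero]) this.symm

/-- The characteristic function of a Gaussian state. -/
theorem pairing_gaussian_expOmega (hA : A.IsSymm) (hIm : (A.map im).PosDef) (c : ℂ)
    (X : Phase ℝ n) :
    pairing (gaussian c A) (expOmega X (gaussian c A)) = gaussNormSq c A *
      Complex.exp (-(1 / 2) *
        ((1 / I) * omega (germProj A (toC X)) (star (germProj A (toC X))))) := by
  set q := germCoord A (toC X) with hq
  set b := cvec X.1 - A *ᵥ cvec X.2 with hb
  have hSq : ((2 : ℂ) • imC A) *ᵥ star q = I • b := by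
    rw [two_smul_imC_mulVec_star_germCoord hIm, toC_eq_cvec, star_cvec, star_cvec]
  -- The solution of S z = b required by the Gaussian integral comes from the conjugate of the germ
  -- coordinate of X.
  have hz : ((2 : ℂ) • imC A) *ᵥ (-I • star q) = b := by
    rw [mulVec_smul, hSq, smul_smul]
    simp
  have hQ : q = cvec X.2 - star q := eq_sub_of_add_eq (germCoord_toC_add_star hIm X)
  have hbQ : cvec X.2 ⬝ᵥ A *ᵥ cvec X.2 - cvec X.1 ⬝ᵥ cvec X.2 = -(b ⬝ᵥ cvec X.2) := by
    rw [hb, sub_dotProduct, dotProduct_comm (A *ᵥ cvec X.2)]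
    ring
  simp only [pairing, star_gaussian_mul_expOmega hA]
  rw [integral_const_mul, integral_gaussExp (isSymm_two_smul_imC hIm) (posDef_two_smul_imC hIm) hz,
    germProj_apply, ← hq, omega_graphMap_star_self hA, hSq, hbQ]
  have h : Complex.exp (I / 2 * -(b ⬝ᵥ cvec X.2)) * Complex.exp (-(1 / 2) * (b ⬝ᵥ -I • star q)) =
      Complex.exp (-(1 / 2) * (q ⬝ᵥ I • b)) := by
    rw [← Complex.exp_add]
    congr 1
    conv_rhs => rw [dotProduct_comm, hQ]
    simp only [dotProduct_sub, dotProduct_smul, smul_dotProduct, smul_eq_mul]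
    ring
  rw [gaussNormSq]
  linear_combination (star c * c * gaussConst ((2 : ℂ) • imC A)) * h

/-- Ω(Y) multiplies the Gaussian by a linear form, so this is a second moment: the covariance
contributes h(V,V) and the mean contributes −|ω(V,X)|², where V is the r-component of Y^*. -/
theorem pairing_Omega_gaussian (hA : A.IsSymm) (hIm : (A.map im).PosDef) (c : ℂ)
    (X : Phase ℝ n) (Y : Phase ℂ n) :
    pairing (Omega Y (gaussian c A)) (expOmega X (Omega Y (gaussian c A))) =
      ((1 / I) * omega (germProj A (star Y)) (star (germProj A (star Y))) -
        omega (germProj A (star Y)) (toC X) * star (omega (germProj A (star Y)) (toC X))) *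
      pairing (gaussian c A) (expOmega X (gaussian c A)) := by
  set S := (2 : ℂ) • imC A with hS
  set q := germCoord A (star Y) with hq
  set b := cvec X.1 - A *ᵥ cvec X.2 with hb
  set v := Y.1 - A *ᵥ Y.2 with hv
  set C := star c * c * Complex.exp
      (I / 2 * (cvec X.2 ⬝ᵥ A *ᵥ cvec X.2 - cvec X.1 ⬝ᵥ cvec X.2)) with hC
  have hSs : S.IsSymm := isSymm_two_smul_imC hIm
  have hSp : (S.map re).PosDef := posDef_two_smul_imC hIm
  have hSq' : S *ᵥ star q = I • v := by
    rw [hS, two_smul_imC_mulVec_star_germCoord hIm]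
    simp [hv]
  have hSq : star v = I • (S *ᵥ q) := by
    have := congrArg star (two_smul_imC_mulVec_star_germCoord hIm (star Y))
    rw [smul_mulVec, star_smul, star_imC_mulVec, star_star, star_smul] at this
    simp only [Prod.fst_star, Prod.snd_star, star_star] at this
    rw [hS, smul_mulVec, hq]
    have h2 : (star (2 : ℂ)) = 2 := by simp
    rw [h2] at this
    rw [this, smul_smul]
    simp [hv]
  -- The conjugate linear factor is i q·Sξ; subtracting I * (b ⬝ᵥ q) makes it the factor absorbed by
  -- integration by parts, and the correction leaves a first moment.
  have hint : ∀ ξ, star (Omega Y (gaussian c A) ξ) * expOmega X (Omega Y (gaussian c A)) ξ =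
      C * I * ((v ⬝ᵥ cvec ξ + -(v ⬝ᵥ cvec X.2)) * (q ⬝ᵥ S *ᵥ cvec ξ - I * (b ⬝ᵥ q)) *
        gaussExp S b ξ) + C * I * (I * (b ⬝ᵥ q)) *
        ((v ⬝ᵥ cvec ξ + -(v ⬝ᵥ cvec X.2)) * gaussExp S b ξ) := fun ξ => by
    have h1 : star (v ⬝ᵥ cvec ξ) = I * (q ⬝ᵥ S *ᵥ cvec ξ) := by
      rw [dotProduct_mulVec_comm hSs, ← smul_eq_mul, ← dotProduct_smul, ← hSq]
      simp [dotProduct, mul_comm]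
    have h2 : expOmega X (Omega Y (gaussian c A)) ξ =
        (v ⬝ᵥ cvec ξ - v ⬝ᵥ cvec X.2) * expOmega X (gaussian c A) ξ := by
      rw [expOmega, expOmega, Omega_gaussian hA, cvec_sub, dotProduct_sub]
      ring
    have h3 := star_gaussian_mul_expOmega hA c X ξ
    rw [h2, Omega_gaussian hA, star_mul', h1]
    rw [← hC, ← hb, ← hS] at h3
    linear_combination (I * (q ⬝ᵥ S *ᵥ cvec ξ) * (v ⬝ᵥ cvec ξ - v ⬝ᵥ cvec X.2)) * h3
  have hE : pairing (gaussian c A) (expOmega X (gaussian c A)) = C * ∫ ξ, gaussExp S b ξ := by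
    simp only [pairing, star_gaussian_mul_expOmega hA]
    rw [integral_const_mul]
  have hv' : v = -I • (S *ᵥ star q) := by
    rw [hSq', smul_smul]
    simp
  have hmean : ∫ ξ, (v ⬝ᵥ cvec ξ + -(v ⬝ᵥ cvec X.2)) * gaussExp S b ξ =
      (b ⬝ᵥ star q - v ⬝ᵥ cvec X.2) * ∫ ξ, gaussExp S b ξ := by
    have h1 := integral_affine_mul_gaussExp hSs hSp b 0 (star q) 1
    simp only [zero_dotProduct, zero_add, one_mul, zero_mul] at h1
    have h2 : ∀ ξ, (v ⬝ᵥ cvec ξ + -(v ⬝ᵥ cvec X.2)) * gaussExp S b ξ =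
        -I * ((star q ⬝ᵥ S *ᵥ cvec ξ - I * (b ⬝ᵥ star q)) * gaussExp S b ξ) +
          (b ⬝ᵥ star q - v ⬝ᵥ cvec X.2) * gaussExp S b ξ := fun ξ => by
      have h3 : v ⬝ᵥ cvec ξ = -I * (star q ⬝ᵥ S *ᵥ cvec ξ) := by
        rw [hv', smul_dotProduct, dotProduct_comm, dotProduct_mulVec_comm hSs, smul_eq_mul]
      linear_combination gaussExp S b ξ * h3 - (b ⬝ᵥ star q) * gaussExp S b ξ * I_mul_I
    simp only [h2]
    rw [integral_add ((integrable_mul_gaussExp hSp b (by fun_prop)).const_mul _)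
      ((integrable_gaussExp hSp b).const_mul _), integral_const_mul, h1, integral_const_mul]
    ring
  have hω : omega (germProj A (star Y)) (toC X) = -(b ⬝ᵥ q) := by
    rw [germProj_apply, ← hq]
    simp only [omega, graphMap_fst, graphMap_snd, toC_eq_cvec, hb, sub_dotProduct]
    rw [dotProduct_comm (A *ᵥ q), dotProduct_mulVec_comm hA, dotProduct_comm q]
    ring
  have hωs : star (omega (germProj A (star Y)) (toC X)) = -(b ⬝ᵥ star q - v ⬝ᵥ cvec X.2) := by
    have hvQ : v = -((A - A.map star) *ᵥ star q) := by
      rw [hv', hS, two_smul_imC, smul_mulVec, smul_smul]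
      simp
    rw [← omega_star_star, star_toC, germProj_apply, ← hq]
    simp only [omega, Prod.fst_star, Prod.snd_star, graphMap_fst, graphMap_snd, toC_eq_cvec]
    rw [star_mulVec_eq, hvQ, sub_mulVec, hb]
    simp only [sub_dotProduct, neg_dotProduct]
    rw [dotProduct_comm (A *ᵥ star q), dotProduct_mulVec_comm hA, dotProduct_comm (star q)]
    ring
  have hself : (1 / I) * omega (germProj A (star Y)) (star (germProj A (star Y))) =
      I * (v ⬝ᵥ q) := by
    rw [germProj_apply, ← hq, omega_graphMap_star_self hA, ← hS, hSq', dotProduct_smul,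
      dotProduct_comm, smul_eq_mul]
  rw [pairing]
  simp only [hint]
  rw [integral_add ((integrable_mul_gaussExp hSp b (by fun_prop)).const_mul _)
    ((integrable_mul_gaussExp hSp b (by fun_prop)).const_mul _), integral_const_mul,
    integral_const_mul, hmean, integral_affine_mul_gaussExp hSs hSp, hself, hωs, hω, hE]
  linear_combination (C * (b ⬝ᵥ q) * (b ⬝ᵥ star q - v ⬝ᵥ cvec X.2) *
    ∫ ξ, gaussExp S b ξ) * I_mul_I

end Pairing

/-! ### Haar measure in basis coordinates. -/

section HaarCoordinates

variable {ι E F : Type} [Fintype ι] [NormedAddCommGroup E] [NormedSpace ℝ E]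
  [MeasurableSpace E] [NormedAddCommGroup F]

theorem measure_parallelepiped_ne_zero (μ : Measure E) [μ.IsAddHaarMeasure]
    (e : Module.Basis ι ℝ E) : μ (parallelepiped e) ≠ 0 := by
  rw [← Module.Basis.coe_parallelepiped]
  exact (Measure.measure_pos_of_nonempty_interior μ e.parallelepiped.interior_nonempty).ne'

theorem measure_parallelepiped_ne_top (μ : Measure E) [μ.IsAddHaarMeasure]
    (e : Module.Basis ι ℝ E) : μ (parallelepiped e) ≠ ⊤ := by
  rw [← Module.Basis.coe_parallelepiped]
  exact e.parallelepiped.isCompact.measure_lt_top.ne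

variable [BorelSpace E]

theorem measurableEmbedding_equivFunL_symm (e : Module.Basis ι ℝ E) :
    MeasurableEmbedding e.equivFunL.symm :=
  e.equivFunL.symm.toHomeomorph.measurableEmbedding

variable [FiniteDimensional ℝ E]

/-- The image of Lebesgue measure gives the parallelepiped of e mass one; uniqueness of Haar measure
fixes the factor. -/
theorem haar_eq_smul_map_equivFun_symm (μ : Measure E) [μ.IsAddHaarMeasure]
    (e : Module.Basis ι ℝ E) :
    μ = μ (parallelepiped e) • Measure.map e.equivFunL.symm volume := by
  have h1 : μ = μ (parallelepiped e) • e.addHaar := by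
    have := Measure.addHaarMeasure_unique μ e.parallelepiped
    rwa [← Module.Basis.addHaar_def, Module.Basis.coe_parallelepiped] at this
  have h2 : Measure.map e.equivFunL.symm (volume : Measure (ι → ℝ)) = e.addHaar := by
    have h3 : (volume : Measure (ι → ℝ)) = (Pi.basisFun ℝ ι).addHaar := by
      rw [Module.Basis.addHaar_def, Module.Basis.parallelepiped_basisFun,
        addHaarMeasure_eq_volume_pi]
    rw [h3, Module.Basis.map_addHaar]
    congr 1
    classical
    ext i
    rw [Module.Basis.map_apply, Pi.basisFun_apply]
    change e.equivFun.symm (Pi.single i 1) = e i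
    simp [Module.Basis.equivFun_symm_apply, Pi.single_apply]
  rw [h2]
  exact h1

theorem integral_haar_eq [NormedSpace ℝ F] (μ : Measure E) [μ.IsAddHaarMeasure]
    (e : Module.Basis ι ℝ E) (f : E → F) :
    ∫ X, f X ∂μ = (μ (parallelepiped e)).toReal • ∫ x, f (e.equivFun.symm x) := by
  conv_lhs => rw [haar_eq_smul_map_equivFun_symm μ e]
  rw [integral_smul_measure,
    (measurableEmbedding_equivFunL_symm e).integral_map f]
  rfl

theorem integrable_haar_iff (μ : Measure E) [μ.IsAddHaarMeasure] (e : Module.Basis ι ℝ E)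
    (f : E → F) : Integrable f μ ↔ Integrable fun x => f (e.equivFun.symm x) := by
  conv_lhs => rw [haar_eq_smul_map_equivFun_symm μ e]
  rw [integrable_smul_measure (measure_parallelepiped_ne_zero μ e)
    (measure_parallelepiped_ne_top μ e),
    (measurableEmbedding_equivFunL_symm e).integrable_map_iff]
  rfl

end HaarCoordinates

/-! ### The constrained norm of Ω(Y)ψ and the H-germ. -/

section ConstrInner

variable {n k : ℕ} {A : Matrix (Fin n) (Fin n) ℂ} {L : Submodule ℝ (Phase ℝ n)} {c : ℂ}

theorem sum_repr_complexBasis (e : Module.Basis (Fin k) ℝ L) (Z : complexify L) :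
    (Z : Phase ℂ n) = ∑ a, (complexBasis e).repr Z a • toC (e a) := by
  conv_lhs => rw [← (complexBasis e).sum_repr Z]
  rw [Submodule.coe_sum]
  exact Finset.sum_congr rfl fun a _ => by rw [complexBasis_apply]; rfl

theorem pairing_gaussian_expOmega_coord (hA : A.IsSymm) (hIm : (A.map im).PosDef)
    (hiso : ∀ X ∈ L, ∀ Y ∈ L, omega X Y = 0) (e : Module.Basis (Fin k) ℝ L) (x : Fin k → ℝ) :
    pairing (gaussian c A) (expOmega (e.equivFun.symm x : Phase ℝ n) (gaussian c A)) =
      gaussNormSq c A * gaussExp ((gramMatrix A e).map ofReal) 0 x := by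
  rw [pairing_gaussian_expOmega hA hIm, toC_equivFun_symm, omega_germProj_sum hA hIm hiso, gaussExp]
  have hs : star (fun a => (x a : ℂ)) = cvec x := star_cvec x
  rw [hs, zero_dotProduct, mul_zero, add_zero]
  rfl

/-- The norm of `Ω(Y) ψ` for the inner product on the physical space. -/
theorem constrInner_Omega_gaussian (hA : A.IsSymm) (hIm : (A.map im).PosDef) (hc : c ≠ 0)
    (hiso : ∀ X ∈ L, ∀ Y ∈ L, omega X Y = 0) (μ : Measure L) [μ.IsAddHaarMeasure]
    (e : Module.Basis (Fin k) ℝ L) {Y Z W : Phase ℂ n} (hZ : Z ∈ complexify L)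
    (hW : W ∈ rPerp L (gaussian c A)) (hY : germProj A (star Y) = germProj A Z + W) :
    constrInner L μ (Omega Y (gaussian c A)) (Omega Y (gaussian c A)) =
      (μ (parallelepiped e)).toReal * (gaussNormSq c A *
        gaussConst ((gramMatrix A e).map ofReal)) * ((1 / I) * omega W (star W)) := by
  set B := (gramMatrix A e).map ofReal with hB
  have hBp := posDef_gramMatrix hA hIm hiso e
  have hBs : B.IsSymm := isSymm_map_ofReal hBp
  have hBre : (B.map re).PosDef := by rwa [hB, map_re_map_ofReal]
  set z : Fin k → ℂ := fun a => (complexBasis e).repr ⟨Z, hZ⟩ a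
  have hZz : Z = ∑ a, z a • toC (e a) := sum_repr_complexBasis e ⟨Z, hZ⟩
  -- No cross terms appear: P₋Z lies in r₋ and W in r_⊥.
  have hself : (1 / I) * omega (germProj A (star Y)) (star (germProj A (star Y))) =
      z ⬝ᵥ B *ᵥ star z + (1 / I) * omega W (star W) := by
    have h1 : omega (germProj A Z) (star W) = 0 := (germProj_mem_rMinus hA hIm hc hZ).2 W hW
    have h2 : omega W (star (germProj A Z)) = 0 := by
      rw [omega_star_right, omega_swap, star_neg, h1, star_zero, neg_zero]
    rw [hY, star_add, omega_add_left, omega_add_right, omega_add_right, h1, h2, add_zero, zero_add,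
      mul_add, hZz, omega_germProj_sum hA hIm hiso e]
  have hlin : ∀ x : Fin k → ℝ,
      omega (germProj A (star Y)) (toC (e.equivFun.symm x : Phase ℝ n)) =
        I * (z ⬝ᵥ B *ᵥ cvec x) := fun x => by
    have h1 := omega_germProj_star hA hIm hc (Z := toC (e.equivFun.symm x : Phase ℝ n))
      (germProj_mem_sGerm hA hc Z)
    rw [star_toC] at h1
    rw [hY, omega_add_left, hW.2 _ (toC_mem_complexify (e.equivFun.symm x).2), add_zero, ← h1,
      toC_equivFun_symm, hZz]
    have h2 := omega_germProj_sum hA hIm hiso e z (cvec x)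
    rw [star_cvec] at h2
    rw [← h2, ← mul_assoc, mul_one_div, div_self I_ne_zero, one_mul]
    rfl
  have hstar : ∀ x : Fin k → ℝ, star (I * (z ⬝ᵥ B *ᵥ cvec x)) =
      -I * ((B *ᵥ star z) ⬝ᵥ cvec x) := fun x => by
    have h1 : star (z ⬝ᵥ B *ᵥ cvec x) = star z ⬝ᵥ B *ᵥ cvec x := by
      simp [hB, dotProduct, mulVec]
    rw [star_mul', h1, dotProduct_mulVec_comm hBs, dotProduct_comm]
    simp
  have hint : ∀ x : Fin k → ℝ,
      pairing (Omega Y (gaussian c A))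
        (expOmega (e.equivFun.symm x : Phase ℝ n) (Omega Y (gaussian c A))) =
      gaussNormSq c A * ((z ⬝ᵥ B *ᵥ star z + (1 / I) * omega W (star W)) * gaussExp B 0 x -
        ((B *ᵥ star z) ⬝ᵥ cvec x + 0) * (z ⬝ᵥ B *ᵥ cvec x - I * (0 ⬝ᵥ z)) * gaussExp B 0 x) :=
      fun x => by
    rw [pairing_Omega_gaussian hA hIm, pairing_gaussian_expOmega_coord hA hIm hiso, hself, hlin,
      hstar, zero_dotProduct]
    linear_combination ((B *ᵥ star z) ⬝ᵥ cvec x * (z ⬝ᵥ B *ᵥ cvec x) * gaussNormSq c A *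
      gaussExp B 0 x) * I_mul_I
  rw [constrInner, integral_haar_eq μ e]
  simp only [hint]
  -- Integration by parts turns the quadratic term into z·Bz̄ times the Gaussian integral,
  -- cancelling h(P₋Z,P₋Z); only h(W,W) survives.
  rw [integral_const_mul, integral_sub ((integrable_gaussExp hBre 0).const_mul _)
    (integrable_mul_gaussExp hBre 0 (by fun_prop)), integral_const_mul,
    integral_affine_mul_gaussExp hBs hBre, dotProduct_comm (B *ᵥ star z), ← gaussConst, real_smul]
  ring

/-- The norm vanishes iff W = 0, that is, iff Y^* and Z have the same r-component for some Z ∈ L^ℂ.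
Then Y − Z^* has no r^*-component, and being skew-orthogonal to L it lies in r_⊥. -/
theorem hGerm_eq (hA : A.IsSymm) (hIm : (A.map im).PosDef) (hc : c ≠ 0)
    (hiso : ∀ X ∈ L, ∀ Y ∈ L, omega X Y = 0) (μ : Measure L) [μ.IsAddHaarMeasure] :
    ((complexify L ⊔ rPerp L (gaussian c A) : Submodule ℂ (Phase ℂ n)) : Set (Phase ℂ n)) =
      hGerm L μ (gaussian c A) := by
  let e := Module.finBasis ℝ L
  ext Y
  obtain ⟨Z, hZ, hW⟩ := exists_germProj_sub_mem_rPerp hA hIm hc hiso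
    (germProj_mem_sGerm hA hc (star Y))
  set W := germProj A (star Y) - germProj A Z with hWdef
  have hYW : germProj A (star Y) = germProj A Z + W := by rw [hWdef]; abel
  have hBp := posDef_gramMatrix hA hIm hiso e
  have hzero : constrInner L μ (Omega Y (gaussian c A)) (Omega Y (gaussian c A)) = 0 ↔ W = 0 := by
    rw [constrInner_Omega_gaussian hA hIm hc hiso μ e hZ hW hYW]
    have h1 : ((μ (parallelepiped e)).toReal : ℂ) ≠ 0 :=
      ofReal_ne_zero.2 (ENNReal.toReal_ne_zero.2
        ⟨measure_parallelepiped_ne_zero μ e, measure_parallelepiped_ne_top μ e⟩)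
    have h2 : gaussConst ((gramMatrix A e).map ofReal) ≠ 0 := by
      have := hBp.det_pos
      rw [gaussConst_ofReal hBp]
      exact ofReal_ne_zero.2 (by positivity)
    have h3 := gaussNormSq_ne_zero hc hIm
    simp only [mul_eq_zero, h1, h2, h3, one_div, inv_eq_zero, I_ne_zero, false_or]
    exact ⟨eq_zero_of_omega_star_self hA hIm hc hW.1, fun h => by simp [h]⟩
  have hY := germProj_add_star hIm Y
  have hle : complexify L ⊔ rPerp L (gaussian c A) ≤ skewOrth (complexify L) :=
    sup_le (complexify_le_skewOrth hiso) inf_le_right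
  simp only [hGerm, SetLike.mem_coe, Set.mem_ofPred_eq]
  rw [hzero]
  constructor
  · intro hYR
    refine ⟨hle hYR, ?_⟩
    obtain ⟨Z', hZ', W', hW', rfl⟩ := Submodule.mem_sup.1 hYR
    rw [star_add, map_add, germProj_star_eq_zero hA hIm hc hW'.1, add_zero] at hWdef
    rw [← map_sub] at hWdef
    have h0 : star Z' - Z = 0 := by
      refine eq_zero_of_omega_germProj hA hIm hc hiso
        (Submodule.sub_mem _ (star_mem_complexify hZ') hZ) ?_
      rw [← hWdef]
      exact hW.2
    rw [hWdef, h0, map_zero]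
  · rintro ⟨hskew, hW0⟩
    rw [hW0, add_zero] at hYW
    have hZ' := star_mem_complexify hZ
    rw [show Y = star Z + (Y - star Z) by abel]
    refine Submodule.add_mem_sup hZ' ⟨?_, Submodule.sub_mem _ hskew
      (complexify_le_skewOrth hiso hZ')⟩
    have hsZ := germProj_add_star hIm (star Z)
    rw [star_star] at hsZ
    have : Y - star Z = germProj A Y - germProj A (star Z) := by
      conv_lhs => rw [← hY, ← hsZ, hYW]
      abel
    rw [this]
    exact Submodule.sub_mem _ (germProj_mem_sGerm hA hc _) (germProj_mem_sGerm hA hc _)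

end ConstrInner

/-! ### The Dirac integral as a Gaussian integral over L. -/

section Dirac

variable {n k : ℕ} {A : Matrix (Fin n) (Fin n) ℂ} {L : Submodule ℝ (Phase ℝ n)} {c : ℂ}

/-- The matrix of the quadratic form in the exponent of the Dirac wave function. -/
def diracMatrix (A : Matrix (Fin n) (Fin n) ℂ) (e : Module.Basis (Fin k) ℝ L) :
    Matrix (Fin k) (Fin k) ℂ :=
  Matrix.of fun a b => I * omega (toC (e a)) (graphMap A (toC (e b)).2)

theorem dotProduct_diracMatrix_mulVec (e : Module.Basis (Fin k) ℝ L) (z w : Fin k → ℂ) :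
    z ⬝ᵥ diracMatrix A e *ᵥ w =
      I * omega (∑ a, z a • toC (e a)) (graphMap A (∑ a, w a • toC (e a)).2) := by
  simp only [diracMatrix, dotProduct, mulVec, of_apply, Prod.snd_sum, Prod.smul_snd, map_sum,
    map_smul, omega_sum_left, omega_sum_right, omega_smul_left, omega_smul_right, Finset.mul_sum]
  rw [Finset.sum_comm]
  exact Finset.sum_congr rfl fun a _ => Finset.sum_congr rfl fun b _ => by ring

/-- The entries are i(P_a·Q_b − Q_a·AQ_b), and isotropy says that P_a·Q_b is symmetric in a and b.
-/
theorem isSymm_diracMatrix (hA : A.IsSymm) (hiso : ∀ X ∈ L, ∀ Y ∈ L, omega X Y = 0)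
    (e : Module.Basis (Fin k) ℝ L) : (diracMatrix A e).IsSymm := by
  ext a b
  have h := omega_toC (e a : Phase ℝ n) (e b)
  rw [hiso _ (e a).2 _ (e b).2, ofReal_zero] at h
  simp only [diracMatrix, transpose_apply, of_apply]
  simp only [omega, graphMap_fst, graphMap_snd] at h ⊢
  rw [dotProduct_comm (A *ᵥ (toC (e b : Phase ℝ n)).2), dotProduct_mulVec_comm hA,
    dotProduct_comm (A *ᵥ (toC (e a : Phase ℝ n)).2)]
  linear_combination (-I) * h

/-- On a real X the term P·Q contributes only an imaginary part, leaving Q·(Im A)Q, and Q ≠ 0 by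
injectivity of the projection. -/
theorem posDef_re_diracMatrix (hA : A.IsSymm) (hIm : (A.map im).PosDef)
    (hiso : ∀ X ∈ L, ∀ Y ∈ L, omega X Y = 0)
    (hproj : Set.InjOn Prod.snd (L : Set (Phase ℝ n))) (e : Module.Basis (Fin k) ℝ L) :
    ((diracMatrix A e).map re).PosDef := by
  refine PosDef.of_dotProduct_mulVec_pos ?_ fun x hx => ?_
  · rw [IsHermitian, conjTranspose_eq_transpose_of_trivial, ← transpose_map,
      (isSymm_diracMatrix hA hiso e).eq]
  · rw [star_trivial, ← re_dotProduct_mulVec_cvec, dotProduct_diracMatrix_mulVec]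
    have hX : ∑ a, cvec x a • toC (e a : Phase ℝ n) = toC (e.equivFun.symm x : Phase ℝ n) :=
      (toC_equivFun_symm e x).symm
    rw [hX]
    set X := e.equivFun.symm x
    have hQ : (X : Phase ℝ n).2 ≠ 0 := fun h0 => hx <| by
      have : X = 0 := Subtype.ext (hproj X.2 L.zero_mem h0)
      exact (LinearEquiv.map_eq_zero_iff _).1 this
    have h1 : I * omega (toC (X : Phase ℝ n)) (graphMap A (toC (X : Phase ℝ n)).2) =
        ((((X : Phase ℝ n).1 ⬝ᵥ (X : Phase ℝ n).2 : ℝ) : ℂ)) * I +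
          cvec (X : Phase ℝ n).2 ⬝ᵥ (-I • A) *ᵥ cvec (X : Phase ℝ n).2 := by
      simp only [omega, graphMap_fst, graphMap_snd, toC_eq_cvec, cvec_dotProduct]
      rw [smul_mulVec, dotProduct_smul, smul_eq_mul, dotProduct_comm (A *ᵥ _)]
      ring
    rw [h1, add_re, re_dotProduct_mulVec_cvec, map_re_neg_I_smul, re_ofReal_mul, I_re, mul_zero,
      zero_add]
    exact dotProduct_mulVec_pos hIm hQ

/-- The linear term in the exponent of the Dirac wave function. -/
def diracVector (A : Matrix (Fin n) (Fin n) ℂ) (e : Module.Basis (Fin k) ℝ L) (ξ : Fin n → ℝ) :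
    Fin k → ℂ := fun a => omega (toC (e a)) (graphMap A (cvec ξ))

theorem diracVector_dotProduct (e : Module.Basis (Fin k) ℝ L) (ξ : Fin n → ℝ) (z : Fin k → ℂ) :
    diracVector A e ξ ⬝ᵥ z = omega (∑ a, z a • toC (e a)) (graphMap A (cvec ξ)) := by
  simp only [diracVector, dotProduct, omega_sum_left, omega_smul_left, mul_comm]

theorem expOmega_gaussian_coord (hA : A.IsSymm) (e : Module.Basis (Fin k) ℝ L) (x : Fin k → ℝ)
    (ξ : Fin n → ℝ) :
    expOmega (e.equivFun.symm x : Phase ℝ n) (gaussian c A) ξ =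
      gaussian c A ξ * gaussExp (diracMatrix A e) (diracVector A e ξ) x := by
  have hX : ∑ a, cvec x a • toC (e a : Phase ℝ n) = toC (e.equivFun.symm x : Phase ℝ n) :=
    (toC_equivFun_symm e x).symm
  rw [expOmega_gaussian hA, gaussExp, diracVector_dotProduct, dotProduct_diracMatrix_mulVec, hX]
  congr 2
  simp only [omega, graphMap_fst, graphMap_snd, toC_eq_cvec, sub_dotProduct]
  rw [dotProduct_comm (A *ᵥ cvec (e.equivFun.symm x : Phase ℝ n).2),
    dotProduct_comm (A *ᵥ cvec (e.equivFun.symm x : Phase ℝ n).2),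
    dotProduct_comm (A *ᵥ cvec ξ), dotProduct_mulVec_comm hA (cvec ξ)]
  ring

theorem exp_omega_coord (e : Module.Basis (Fin k) ℝ L) (x : Fin k → ℝ) :
    Complex.exp (-(I / 2) * omega (toC (e.equivFun.symm x : Phase ℝ n))
      (graphMap A (toC (e.equivFun.symm x : Phase ℝ n)).2)) = gaussExp (diracMatrix A e) 0 x := by
  have hX : ∑ a, cvec x a • toC (e a : Phase ℝ n) = toC (e.equivFun.symm x : Phase ℝ n) :=
    (toC_equivFun_symm e x).symm
  rw [gaussExp, dotProduct_diracMatrix_mulVec, hX, zero_dotProduct]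
  congr 1
  ring

theorem integrable_expOmega_gaussian (hA : A.IsSymm) (hIm : (A.map im).PosDef)
    (hiso : ∀ X ∈ L, ∀ Y ∈ L, omega X Y = 0)
    (hproj : Set.InjOn Prod.snd (L : Set (Phase ℝ n))) (μ : Measure L) [μ.IsAddHaarMeasure]
    (ξ : Fin n → ℝ) :
    Integrable (fun X : L => expOmega (X : Phase ℝ n) (gaussian c A) ξ) μ := by
  rw [integrable_haar_iff μ (Module.finBasis ℝ L)]
  simp only [expOmega_gaussian_coord hA]
  exact (integrable_gaussExp (posDef_re_diracMatrix hA hIm hiso hproj _) _).const_mul _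

theorem integrable_exp_omega (hA : A.IsSymm) (hIm : (A.map im).PosDef)
    (hiso : ∀ X ∈ L, ∀ Y ∈ L, omega X Y = 0)
    (hproj : Set.InjOn Prod.snd (L : Set (Phase ℝ n))) (μ : Measure L) [μ.IsAddHaarMeasure] :
    Integrable (fun X : L => Complex.exp (-(I / 2) * omega (toC (X : Phase ℝ n))
      (graphMap A (toC (X : Phase ℝ n)).2))) μ := by
  rw [integrable_haar_iff μ (Module.finBasis ℝ L)]
  simp only [exp_omega_coord]
  exact integrable_gaussExp (posDef_re_diracMatrix hA hIm hiso hproj _) _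

theorem integral_exp_omega (μ : Measure L) [μ.IsAddHaarMeasure] (e : Module.Basis (Fin k) ℝ L) :
    ∫ X : L, Complex.exp (-(I / 2) * omega (toC (X : Phase ℝ n))
      (graphMap A (toC (X : Phase ℝ n)).2)) ∂μ =
      (μ (parallelepiped e)).toReal * gaussConst (diracMatrix A e) := by
  rw [integral_haar_eq μ e]
  simp only [exp_omega_coord, real_smul]
  rfl

/-- The Dirac wave function is Gaussian. -/
theorem integral_expOmega_gaussian (hA : A.IsSymm) (hIm : (A.map im).PosDef)
    (hiso : ∀ X ∈ L, ∀ Y ∈ L, omega X Y = 0)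
    (hproj : Set.InjOn Prod.snd (L : Set (Phase ℝ n))) (μ : Measure L) [μ.IsAddHaarMeasure]
    {σ : (Fin n → ℂ) →ₗ[ℂ] complexify L}
    (hσ : ∀ v, graphMap A v - graphMap A (σ v : Phase ℂ n).2 ∈ rPerp L (gaussian c A))
    {A' : Matrix (Fin n) (Fin n) ℂ}
    (hA' : ∀ v, A' *ᵥ v = (σ v : Phase ℂ n).1 + A *ᵥ (v - (σ v : Phase ℂ n).2)) (ξ : Fin n → ℝ) :
    ∫ X : L, expOmega (X : Phase ℝ n) (gaussian c A) ξ ∂μ =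
      gaussian (c * ∫ X : L, Complex.exp (-(I / 2) * omega (toC (X : Phase ℝ n))
        (graphMap A (toC (X : Phase ℝ n)).2)) ∂μ) A' ξ := by
  let e := Module.finBasis ℝ L
  set w : Fin (Module.finrank ℝ L) → ℂ := fun a => (complexBasis e).repr (σ (cvec ξ)) a
  have hσw : (σ (cvec ξ) : Phase ℂ n) = ∑ a, w a • toC (e a) := sum_repr_complexBasis e _
  have hIw : ∑ a, (-I • w) a • toC (e a : Phase ℝ n) = -I • (σ (cvec ξ) : Phase ℂ n) := by
    rw [hσw, Finset.smul_sum]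
    exact Finset.sum_congr rfl fun a _ => by rw [Pi.smul_apply, smul_assoc]
  -- The stationary point is −i times the coordinates of σ(ξ); the equation for row a is the r_⊥
  -- relation of σ paired with e_a.
  have hz : diracMatrix A e *ᵥ (-I • w) = diracVector A e ξ := by
    ext a
    have h1 := dotProduct_diracMatrix_mulVec (A := A) e (Pi.single a 1) (-I • w)
    have h2 : ∑ b, (Pi.single a (1 : ℂ) : Fin _ → ℂ) b • toC (e b : Phase ℝ n) =
        toC (e a : Phase ℝ n) := by
      simp [Pi.single_apply]
    rw [single_one_dotProduct, hIw, h2, Prod.smul_snd, map_smul, omega_smul_right] at h1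
    have h3 := (hσ (cvec ξ)).2 _ (toC_mem_complexify (e a).2)
    rw [omega_sub_left, omega_swap, omega_swap (graphMap A (σ (cvec ξ) : Phase ℂ n).2)] at h3
    rw [h1, diracVector]
    linear_combination (-(omega (toC (e a : Phase ℝ n))
      (graphMap A (σ (cvec ξ) : Phase ℂ n).2))) * I_mul_I + h3
  rw [integral_exp_omega μ e, integral_haar_eq μ e]
  simp only [expOmega_gaussian_coord hA]
  rw [integral_const_mul, integral_gaussExp (isSymm_diracMatrix hA hiso e)
    (posDef_re_diracMatrix hA hIm hiso hproj e) hz, diracVector_dotProduct, hIw, omega_smul_left,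
    gaussian_apply, gaussian_apply, hA', real_smul]
  -- Completing the square adds ω(σξ, (Aξ,ξ)) to ξ·Aξ, which gives ξ·A'ξ.
  have h : Complex.exp (I / 2 * (cvec ξ ⬝ᵥ A *ᵥ cvec ξ)) * Complex.exp (-(1 / 2) *
      (-I * omega (σ (cvec ξ) : Phase ℂ n) (graphMap A (cvec ξ)))) =
      Complex.exp (I / 2 * (cvec ξ ⬝ᵥ
        ((σ (cvec ξ) : Phase ℂ n).1 + A *ᵥ (cvec ξ - (σ (cvec ξ) : Phase ℂ n).2)))) := by
    rw [← Complex.exp_add]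
    congr 1
    simp only [omega, graphMap_fst, graphMap_snd, dotProduct_add, mulVec_sub, dotProduct_sub]
    rw [dotProduct_comm (A *ᵥ cvec ξ), dotProduct_mulVec_comm hA (cvec ξ) (σ (cvec ξ) : Phase ℂ n).2,
      dotProduct_comm (cvec ξ) (σ (cvec ξ) : Phase ℂ n).1]
    ring
  linear_combination (c * (μ (parallelepiped e)).toReal * gaussConst (diracMatrix A e)) * h

end Dirac

/-! ### The Dirac wave function tested against Schwartz functions. -/

section Distribution

variable {n : ℕ} {A : Matrix (Fin n) (Fin n) ℂ} {L : Submodule ℝ (Phase ℝ n)}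

theorem exists_norm_gaussian_le (c : ℂ) (hIm : (A.map im).PosDef) (N : ℕ) :
    ∃ C ≥ 0, ∀ ξ, (1 + ‖ξ‖) ^ N * ‖gaussian c A ξ‖ ≤ C := by
  obtain ⟨C, hC, h⟩ := exists_norm_gaussExp_le (S := -I • A) (by rwa [map_re_neg_I_smul]) 0 N
  refine ⟨‖c‖ * C, by positivity, fun ξ => ?_⟩
  rw [gaussian_eq, norm_mul, mul_left_comm]
  gcongr
  exact h ξ

theorem norm_expOmega (X : Phase ℝ n) (ψ : (Fin n → ℝ) → ℂ) (ξ : Fin n → ℝ) :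
    ‖expOmega X ψ ξ‖ = ‖ψ (ξ - X.2)‖ := by
  rw [expOmega, norm_mul, norm_exp_I_mul_ofReal, one_mul]

/-- An injective linear map on a finite-dimensional space is bounded below, so decay in Q is decay
in X. -/
theorem exists_one_add_norm_le (hproj : Set.InjOn Prod.snd (L : Set (Phase ℝ n))) :
    ∃ M ≥ 0, ∀ X : L, 1 + ‖X‖ ≤ M * (1 + ‖(X : Phase ℝ n).2‖) := by
  let g : L →ₗ[ℝ] (Fin n → ℝ) := (LinearMap.snd ℝ _ _).domRestrict L
  have hg : LinearMap.ker g = ⊥ := LinearMap.ker_eq_bot.2 fun X Y h =>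
    Subtype.ext (hproj X.2 Y.2 h)
  obtain ⟨K, -, hK⟩ := g.exists_antilipschitzWith hg
  refine ⟨1 + K, by positivity, fun X => ?_⟩
  have h : ‖X‖ ≤ K * ‖(X : Phase ℝ n).2‖ := by
    have := hK.le_mul_dist X 0
    simpa [g] using this
  nlinarith [norm_nonneg (X : Phase ℝ n).2, K.coe_nonneg]

theorem continuous_expOmega_gaussian (c : ℂ) :
    Continuous fun p : L × (Fin n → ℝ) => expOmega (p.1 : Phase ℝ n) (gaussian c A) p.2 := by
  unfold expOmega gaussian dotProduct
  simp only [Pi.sub_apply]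
  fun_prop

/-- The integrand of the Dirac wave function, tested against a Schwartz function. -/
theorem integrable_schwartz_mul_expOmega (c : ℂ) (hIm : (A.map im).PosDef)
    (hproj : Set.InjOn Prod.snd (L : Set (Phase ℝ n))) (μ : Measure L) [μ.IsAddHaarMeasure]
    (φ : 𝓢(Fin n → ℝ, ℂ)) :
    Integrable (fun p : L × (Fin n → ℝ) =>
      star (φ p.2) * expOmega (p.1 : Phase ℝ n) (gaussian c A) p.2) (μ.prod volume) := by
  -- One power more than the dimension of L makes (1 + ‖X‖)^{-N} integrable.
  set N := Module.finrank ℝ L + 1 with hN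
  obtain ⟨C, hC, hbound⟩ := exists_norm_gaussian_le c hIm N
  obtain ⟨M, hM, hle⟩ := exists_one_add_norm_le hproj
  have h1 : Integrable (fun X : L => C * M ^ N * (1 + ‖X‖) ^ (-(N : ℝ))) μ :=
    (integrable_one_add_norm (by rw [hN]; push_cast; linarith)).const_mul _
  have h2 : Integrable fun ξ : Fin n → ℝ => 2 ^ (N - 1) * (‖φ ξ‖ + ‖ξ‖ ^ N * ‖φ ξ‖) := by
    have := (φ.integrable_pow_mul volume 0).add (φ.integrable_pow_mul volume N)
    simpa using this.const_mul (2 ^ (N - 1))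
  refine (h1.mul_prod h2).mono' ?_ (Filter.Eventually.of_forall fun p => ?_)
  · exact ((φ.continuous.comp continuous_snd).star.mul
      (continuous_expOmega_gaussian c)).aestronglyMeasurable
  obtain ⟨X, ξ⟩ := p
  simp only
  rw [norm_mul, norm_star, norm_expOmega, Real.rpow_neg (by positivity), Real.rpow_natCast]
  set Q := (X : Phase ℝ n).2
  -- A Peetre-type inequality: decay of the Gaussian in ξ − Q becomes decay in Q, at the price of a
  -- power of 1 + ‖ξ‖ that the Schwartz function absorbs.
  have h3 : 1 + ‖Q‖ ≤ (1 + ‖ξ - Q‖) * (1 + ‖ξ‖) := by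
    have : ‖Q‖ ≤ ‖ξ‖ + ‖ξ - Q‖ := by
      have := norm_sub_le ξ (ξ - Q)
      rwa [sub_sub_cancel] at this
    nlinarith [norm_nonneg ξ, norm_nonneg (ξ - Q)]
  have h4 : (1 + ‖X‖) ^ N ≤ M ^ N * ((1 + ‖ξ - Q‖) ^ N * (1 + ‖ξ‖) ^ N) := by
    rw [← mul_pow, ← mul_pow]
    gcongr
    exact (hle X).trans (by gcongr)
  have h5 : (1 + ‖ξ‖) ^ N ≤ 2 ^ (N - 1) * (1 + ‖ξ‖ ^ N) := by
    simpa using add_pow_le zero_le_one (norm_nonneg ξ) N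
  have h6 : 0 < (1 + ‖X‖) ^ N := by positivity
  calc ‖φ ξ‖ * ‖gaussian c A (ξ - Q)‖
      = ‖φ ξ‖ * ‖gaussian c A (ξ - Q)‖ * (1 + ‖X‖) ^ N * ((1 + ‖X‖) ^ N)⁻¹ := by
        field_simp
    _ ≤ ‖φ ξ‖ * ‖gaussian c A (ξ - Q)‖ * (M ^ N * ((1 + ‖ξ - Q‖) ^ N * (1 + ‖ξ‖) ^ N)) *
        ((1 + ‖X‖) ^ N)⁻¹ := by gcongr
    _ = ((1 + ‖ξ - Q‖) ^ N * ‖gaussian c A (ξ - Q)‖) * (M ^ N * ((1 + ‖X‖) ^ N)⁻¹ *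
        (‖φ ξ‖ * (1 + ‖ξ‖) ^ N)) := by ring
    _ ≤ C * (M ^ N * ((1 + ‖X‖) ^ N)⁻¹ * (‖φ ξ‖ * (2 ^ (N - 1) * (1 + ‖ξ‖ ^ N)))) := by
        gcongr
        exact hbound _
    _ = _ := by ring

theorem pairing_integral_expOmega (c : ℂ) (hIm : (A.map im).PosDef)
    (hproj : Set.InjOn Prod.snd (L : Set (Phase ℝ n))) (μ : Measure L) [μ.IsAddHaarMeasure]
    (φ : 𝓢(Fin n → ℝ, ℂ)) {D : (Fin n → ℝ) → ℂ}
    (hD : ∀ ξ, ∫ X : L, expOmega (X : Phase ℝ n) (gaussian c A) ξ ∂μ = D ξ) :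
    Integrable (fun X : L => pairing φ (expOmega (X : Phase ℝ n) (gaussian c A))) μ ∧
      Integrable (fun ξ => star (φ ξ) * D ξ) ∧
      ∫ X : L, pairing φ (expOmega (X : Phase ℝ n) (gaussian c A)) ∂μ = pairing φ D := by
  have h := integrable_schwartz_mul_expOmega (A := A) c hIm hproj μ φ
  have hin : ∀ ξ, ∫ X : L, star (φ ξ) * expOmega (X : Phase ℝ n) (gaussian c A) ξ ∂μ =
      star (φ ξ) * D ξ := fun ξ => by rw [integral_const_mul, hD]
  refine ⟨h.integral_prod_left, ?_, ?_⟩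
  · have := h.integral_prod_right
    simpa only [hin] using this
  · simp only [pairing]
    rw [integral_integral_swap h]
    simp only [hin]

end Distribution

/-! ### The operator T, its determinant and the Jacobian of P₋. -/

section Determinant

variable {n k : ℕ} {A : Matrix (Fin n) (Fin n) ℂ} {L : Submodule ℝ (Phase ℝ n)} {c : ℂ}

/-- Modulo r_⊥, which pairs to zero with L, the lift to r of the Q-part of TZ is P₋Z. Pairing with
e_a then gives the Gram entry. -/
theorem diracMatrix_mul_toMatrix (hA : A.IsSymm) (hIm : (A.map im).PosDef) (hc : c ≠ 0)
    (hiso : ∀ X ∈ L, ∀ Y ∈ L, omega X Y = 0) (e : Module.Basis (Fin k) ℝ L)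
    {σ : (Fin n → ℂ) →ₗ[ℂ] complexify L}
    (hσ : ∀ v, graphMap A v - graphMap A (σ v : Phase ℂ n).2 ∈ rPerp L (gaussian c A))
    {T : complexify L →ₗ[ℂ] complexify L} (hT : ∀ Z, T Z = σ (germCoord A Z)) :
    diracMatrix A e * LinearMap.toMatrix (complexBasis e) (complexBasis e) T =
      (gramMatrix A e).map ofReal := by
  have hs : (gramMatrix A e).map ofReal = ((gramMatrix A e).map ofReal)ᵀ :=
    (isSymm_map_ofReal (posDef_gramMatrix hA hIm hiso e)).eq.symm
  rw [hs, gramMatrix_map_ofReal hA hIm hiso]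
  ext a b
  set τ := LinearMap.toMatrix (complexBasis e) (complexBasis e) T with hτ
  have h1 : (diracMatrix A e * τ) a b = Pi.single a 1 ⬝ᵥ diracMatrix A e *ᵥ fun i => τ i b := by
    rw [single_one_dotProduct]
    rfl
  have h2 : ∑ i, (Pi.single a (1 : ℂ) : Fin k → ℂ) i • toC (e i : Phase ℝ n) =
      toC (e a : Phase ℝ n) := by
    simp [Pi.single_apply]
  have h3 : ∑ i, τ i b • toC (e i : Phase ℝ n) = (T (inC L (e b)) : Phase ℂ n) := by
    rw [sum_repr_complexBasis e (T (inC L (e b)))]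
    simp [hτ, LinearMap.toMatrix_apply]
  have h4 := (hσ (germCoord A (toC (e b)))).2 _ (toC_mem_complexify (e a).2)
  rw [← germProj_apply] at h4
  have h5 := omega_germProj_star hA hIm hc (Z := toC (e a : Phase ℝ n))
    (germProj_mem_sGerm hA hc (toC (e b : Phase ℝ n)))
  rw [star_toC] at h5
  rw [h1, dotProduct_diracMatrix_mulVec, h2, h3, hT, transpose_apply, of_apply, h5, omega_swap]
  change I * -omega (graphMap A (σ (germCoord A (toC (e b : Phase ℝ n))) : Phase ℂ n).2)
    (toC (e a : Phase ℝ n)) = _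
  rw [omega_sub_left] at h4
  simp only [one_div, inv_I]
  linear_combination I * h4

/-- If P is the matrix of P₋ and H the Gram matrix of f, then B = Pᵀ H P̄, so det B = |det P|² det H
and the choice of f drops out. -/
theorem jacobianMinus_eq (hA : A.IsSymm) (hIm : (A.map im).PosDef)
    (hiso : ∀ X ∈ L, ∀ Y ∈ L, omega X Y = 0) (μ : Measure L)
    {Pm : complexify L →ₗ[ℂ] rMinus L (gaussian c A)}
    (hPm : ∀ Z, (Pm Z : Phase ℂ n) = germProj A Z)
    (e : Module.Basis (Fin k) ℝ L) (f : Module.Basis (Fin k) ℂ (rMinus L (gaussian c A))) :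
    jacobianMinus μ Pm e f =
      Real.sqrt (gramMatrix A e).det / (μ (parallelepiped e)).toReal := by
  set P : Matrix (Fin k) (Fin k) ℂ := Matrix.of fun a b => f.repr (Pm (inC L (e b))) a with hP
  set H : Matrix (Fin k) (Fin k) ℂ := Matrix.of fun a b =>
      (1 / I) * omega (f a : Phase ℂ n) (star (f b : Phase ℂ n)) with hH
  have hexp : ∀ b, germProj A (toC (e b : Phase ℝ n)) = ∑ a, P a b • (f a : Phase ℂ n) :=
      fun b => by
    have h := congrArg Subtype.val (f.sum_repr (Pm (inC L (e b))))
    rw [hPm, Submodule.coe_sum] at h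
    exact h.symm
  have hB : (gramMatrix A e).map ofReal = Pᵀ * H * P.map star := by
    rw [gramMatrix_map_ofReal hA hIm hiso]
    ext a b
    simp only [of_apply, hexp, star_sum, star_smul, omega_sum_left, omega_sum_right,
      omega_smul_left, omega_smul_right, Matrix.mul_apply, transpose_apply, map_apply, hH,
      Finset.mul_sum, Finset.sum_mul]
    exact Finset.sum_congr rfl fun i _ => Finset.sum_congr rfl fun j _ => by ring
  have hdet : ((gramMatrix A e).det : ℂ) = P.det * H.det * star P.det := by
    have h1 : ((gramMatrix A e).map ofReal).det = (((gramMatrix A e).det : ℝ) : ℂ) :=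
      (RingHom.map_det ofRealHom _).symm
    have h2 : (P.map star).det = star P.det := (RingHom.map_det (starRingEnd ℂ) P).symm
    rw [← h1, hB, det_mul, det_mul, det_transpose, h2]
  have hpos := (posDef_gramMatrix hA hIm hiso e).det_pos
  have hnorm : (gramMatrix A e).det = ‖P.det‖ ^ 2 * ‖H.det‖ := by
    have h := congrArg norm hdet
    rw [norm_real, Real.norm_of_nonneg hpos.le, norm_mul, norm_mul, norm_star] at h
    rw [h]
    ring
  rw [jacobianMinus, hnorm, Real.sqrt_mul (by positivity), Real.sqrt_sq (norm_nonneg _)]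

theorem sqrtDet_sq {V : Type} [AddCommGroup V] [Module ℂ V] [Module.Finite ℂ V]
    (T : V →ₗ[ℂ] V) : sqrtDet T ^ 2 = LinearMap.det T := by
  rw [sqrtDet, prod_map_cpow_half_sq,
    Module.End.det_eq_prod_roots_charpoly_of_splits (IsAlgClosed.splits _)]

theorem gaussConst_diracMatrix (hA : A.IsSymm) (hIm : (A.map im).PosDef) (hc : c ≠ 0)
    (hiso : ∀ X ∈ L, ∀ Y ∈ L, omega X Y = 0)
    (hproj : Set.InjOn Prod.snd (L : Set (Phase ℝ n))) (e : Module.Basis (Fin k) ℝ L)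
    {σ : (Fin n → ℂ) →ₗ[ℂ] complexify L}
    (hσ : ∀ v, graphMap A v - graphMap A (σ v : Phase ℂ n).2 ∈ rPerp L (gaussian c A))
    {T : complexify L →ₗ[ℂ] complexify L} (hT : ∀ Z, T Z = σ (germCoord A Z)) :
    gaussConst (diracMatrix A e) =
      (((2 * Real.pi) ^ ((k : ℝ) / 2) / Real.sqrt (gramMatrix A e).det : ℝ) : ℂ) * sqrtDet T := by
  have h := gaussConst_eq (isSymm_diracMatrix hA hiso e) (posDef_re_diracMatrix hA hIm hiso hproj e)
    (posDef_gramMatrix hA hIm hiso e) (diracMatrix_mul_toMatrix hA hIm hc hiso e hσ hT)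
  rwa [LinearMap.charpoly_toMatrix, Fintype.card_fin] at h

theorem re_pos_of_hasEigenvalue (hA : A.IsSymm) (hIm : (A.map im).PosDef) (hc : c ≠ 0)
    (hiso : ∀ X ∈ L, ∀ Y ∈ L, omega X Y = 0)
    (hproj : Set.InjOn Prod.snd (L : Set (Phase ℝ n)))
    {σ : (Fin n → ℂ) →ₗ[ℂ] complexify L}
    (hσ : ∀ v, graphMap A v - graphMap A (σ v : Phase ℂ n).2 ∈ rPerp L (gaussian c A))
    {T : complexify L →ₗ[ℂ] complexify L} (hT : ∀ Z, T Z = σ (germCoord A Z)) {z : ℂ}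
    (hz : Module.End.HasEigenvalue T z) : 0 < z.re := by
  let e := Module.finBasis ℝ L
  refine re_pos_of_mem_roots_charpoly (isSymm_diracMatrix hA hiso e)
    (posDef_re_diracMatrix hA hIm hiso hproj e) (posDef_gramMatrix hA hIm hiso e)
    (diracMatrix_mul_toMatrix hA hIm hc hiso e hσ hT) ?_
  rw [LinearMap.charpoly_toMatrix]
  exact Polynomial.mem_roots'.2 ⟨T.charpoly_monic.ne_zero,
    (Module.End.hasEigenvalue_iff_isRoot_charpoly T z).1 hz⟩

end Determinant

/-! ### The projections Č and Π on L^ℂ + r_⊥. -/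

section Projections

variable {n : ℕ} {A : Matrix (Fin n) (Fin n) ℂ} {L : Submodule ℝ (Phase ℝ n)} {c : ℂ}

theorem projQInv_eq {R : Submodule ℂ (Phase ℂ n)} (h : Function.Bijective (projQ R)) {Y : R}
    {v : Fin n → ℂ} (hY : (Y : Phase ℂ n).2 = v) : projQInv h v = Y := by
  subst hY
  exact (LinearEquiv.ofBijective (projQ R) h).symm_apply_apply Y

theorem bijective_projQ_sGerm (hA : A.IsSymm) (hc : c ≠ 0) :
    Function.Bijective (projQ (sGerm (gaussian c A))) := by
  refine ⟨fun Y Y' h => Subtype.ext ?_, fun v => ⟨⟨_, graphMap_mem_sGerm hA hc v⟩, rfl⟩⟩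
  rw [← graphMap_snd_of_mem_sGerm hA hc Y.2, ← graphMap_snd_of_mem_sGerm hA hc Y'.2]
  exact congrArg (graphMap A) h

variable {σ : (Fin n → ℂ) →ₗ[ℂ] complexify L}

/-- Together with `projection_rPerp`, this makes Y ↦ σ(Q) the projection of L^ℂ + r_⊥ onto L^ℂ along
r_⊥. -/
theorem projection_complexify (hA : A.IsSymm) (hIm : (A.map im).PosDef)
    (hiso : ∀ X ∈ L, ∀ Y ∈ L, omega X Y = 0)
    (hproj : Set.InjOn Prod.snd (L : Set (Phase ℝ n)))
    (hσ : ∀ v, graphMap A v - graphMap A (σ v : Phase ℂ n).2 ∈ rPerp L (gaussian c A))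
    (Z : complexify L) : σ (Z : Phase ℂ n).2 = Z := by
  have h := hσ (Z : Phase ℂ n).2
  rw [← map_sub, ← Prod.snd_sub] at h
  exact (Subtype.ext (sub_eq_zero.1 (eq_zero_of_mem_complexify_of_mem_rPerp hA hIm hiso hproj
    (Submodule.sub_mem _ Z.2 (σ _).2) h))).symm

theorem projection_rPerp (hA : A.IsSymm) (hIm : (A.map im).PosDef) (hc : c ≠ 0)
    (hiso : ∀ X ∈ L, ∀ Y ∈ L, omega X Y = 0)
    (hproj : Set.InjOn Prod.snd (L : Set (Phase ℝ n)))
    (hσ : ∀ v, graphMap A v - graphMap A (σ v : Phase ℂ n).2 ∈ rPerp L (gaussian c A))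
    {W : Phase ℂ n} (hW : W ∈ rPerp L (gaussian c A)) : σ W.2 = 0 := by
  have h := Submodule.sub_mem _ hW (hσ W.2)
  rw [graphMap_snd_of_mem_sGerm hA hc hW.1, sub_sub_cancel] at h
  exact Subtype.ext (eq_zero_of_mem_complexify_of_mem_rPerp hA hIm hiso hproj (σ _).2 h)

theorem sub_projection_mem_rPerp (hA : A.IsSymm) (hIm : (A.map im).PosDef) (hc : c ≠ 0)
    (hiso : ∀ X ∈ L, ∀ Y ∈ L, omega X Y = 0)
    (hproj : Set.InjOn Prod.snd (L : Set (Phase ℝ n)))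
    (hσ : ∀ v, graphMap A v - graphMap A (σ v : Phase ℂ n).2 ∈ rPerp L (gaussian c A))
    {Y : Phase ℂ n} (hY : Y ∈ complexify L ⊔ rPerp L (gaussian c A)) :
    Y - σ Y.2 ∈ rPerp L (gaussian c A) := by
  obtain ⟨Z, hZ, W, hW, rfl⟩ := Submodule.mem_sup.1 hY
  rw [Prod.snd_add, map_add, projection_rPerp hA hIm hc hiso hproj hσ hW, add_zero,
    projection_complexify hA hIm hiso hproj hσ ⟨Z, hZ⟩, add_sub_cancel_left]
  exact hW

/-- The explicit inverse of Č: σ(v) plus the remainder in r_⊥. -/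
theorem section_mem (hσ : ∀ v, graphMap A v - graphMap A (σ v : Phase ℂ n).2 ∈
    rPerp L (gaussian c A)) (v : Fin n → ℂ) :
    (σ v : Phase ℂ n) + (graphMap A v - graphMap A (σ v : Phase ℂ n).2) ∈
      complexify L ⊔ rPerp L (gaussian c A) :=
  Submodule.add_mem_sup (σ v).2 (hσ v)

theorem section_snd (v : Fin n → ℂ) :
    ((σ v : Phase ℂ n) + (graphMap A v - graphMap A (σ v : Phase ℂ n).2)).2 = v := by
  simp

theorem bijective_projQ_sup (hA : A.IsSymm) (hIm : (A.map im).PosDef) (hc : c ≠ 0)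
    (hiso : ∀ X ∈ L, ∀ Y ∈ L, omega X Y = 0)
    (hproj : Set.InjOn Prod.snd (L : Set (Phase ℝ n)))
    (hσ : ∀ v, graphMap A v - graphMap A (σ v : Phase ℂ n).2 ∈ rPerp L (gaussian c A)) :
    Function.Bijective (projQ (complexify L ⊔ rPerp L (gaussian c A))) := by
  refine ⟨(injective_iff_map_eq_zero _).2 fun Y hY => ?_,
    fun v => ⟨⟨_, section_mem hσ v⟩, section_snd v⟩⟩
  have hY0 : (Y : Phase ℂ n).2 = 0 := hY
  have h := sub_projection_mem_rPerp hA hIm hc hiso hproj hσ Y.2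
  rw [hY0, map_zero, ZeroMemClass.coe_zero, sub_zero] at h
  refine Subtype.ext ?_
  rw [← graphMap_snd_of_mem_sGerm hA hc h.1, hY0, map_zero]
  rfl

end Projections

end LinearConstraint

end

/-! ### Assembly of the theorem. -/

theorem lemma14 {n k : ℕ} (L : Submodule ℝ (Phase ℝ n)) (hk : Module.finrank ℝ L = k)
    (hiso : ∀ X ∈ L, ∀ Y ∈ L, omega X Y = 0)
    (hproj : Set.InjOn Prod.snd (L : Set (Phase ℝ n)))
    (μ : Measure L) [μ.IsAddHaarMeasure]
    (A : Matrix (Fin n) (Fin n) ℂ) (hA : A.IsSymm) (hIm : (A.map Complex.im).PosDef)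
    (c : ℂ) (hc : c ≠ 0) :
    ∃ (R : Submodule ℂ (Phase ℂ n)) (hLR : complexify L ≤ R)
      (hC : Function.Bijective (projQ (sGerm (gaussian c A))))
      (hC' : Function.Bijective (projQ R))
      (Pm : complexify L →ₗ[ℂ] rMinus L (gaussian c A))
      (Pr : R →ₗ[ℂ] complexify L)
      (PP : R →ₗ[ℂ] sGerm (gaussian c A))
      (A' : Matrix (Fin n) (Fin n) ℂ) (c' : ℂ) (T : complexify L →ₗ[ℂ] complexify L),
      -- the H-germ is the subspace `R`; the operators `P₋`, `Π`, `𝒫₋` exist and are unique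
      (R : Set (Phase ℂ n)) = hGerm L μ (gaussian c A) ∧
      (IsPMinus Pm ∧ (∀ Pm' : complexify L →ₗ[ℂ] rMinus L (gaussian c A),
        IsPMinus Pm' → Pm' = Pm) ∧ Function.Bijective Pm) ∧
      (IsPi L (gaussian c A) Pr ∧ ∀ Pr' : R →ₗ[ℂ] complexify L,
        IsPi L (gaussian c A) Pr' → Pr' = Pr) ∧
      (IsCalPMinus Pm PP ∧ ∀ PP' : R →ₗ[ℂ] sGerm (gaussian c A),
        IsCalPMinus Pm PP' → PP' = PP) ∧
      -- the Dirac wave function, pointwise and as a distribution, is the Gaussian of `c'`, `A'`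
      (∀ ξ, Integrable (fun X : L => expOmega (X : Phase ℝ n) (gaussian c A) ξ) μ ∧
        ∫ X : L, expOmega (X : Phase ℝ n) (gaussian c A) ξ ∂μ = gaussian c' A' ξ) ∧
      (∀ φ : 𝓢(Fin n → ℝ, ℂ),
        Integrable (fun X : L => pairing φ (expOmega (X : Phase ℝ n) (gaussian c A))) μ ∧
        Integrable (fun ξ => star (φ ξ) * gaussian c' A' ξ) ∧
        ∫ X : L, pairing φ (expOmega (X : Phase ℝ n) (gaussian c A)) ∂μ =
          pairing φ (gaussian c' A')) ∧
      -- the matrix `A'`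
      A' = LinearMap.toMatrix' (projP R ∘ₗ projQInv hC') ∧
      -- the constant `c'`, as an integral
      Integrable (fun X : L => Complex.exp (-(Complex.I / 2) * omega (toC (X : Phase ℝ n))
        (projQInv hC (projQ R ⟨toC (X : Phase ℝ n), hLR (inC L X).2⟩) : Phase ℂ n))) μ ∧
      c' = c * ∫ X : L, Complex.exp (-(Complex.I / 2) * omega (toC (X : Phase ℝ n))
        (projQInv hC (projQ R ⟨toC (X : Phase ℝ n), hLR (inC L X).2⟩) : Phase ℂ n)) ∂μ ∧
      -- the constant `c'`, through the determinant of `T = Π Č⁻¹ C 𝒫₋` on `L^ℂ`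
      T = Pr ∘ₗ projQInv hC' ∘ₗ projQ (sGerm (gaussian c A)) ∘ₗ PP ∘ₗ
        Submodule.inclusion hLR ∧
      (∀ z : ℂ, Module.End.HasEigenvalue T z → 0 < z.re) ∧
      sqrtDet T ^ 2 = LinearMap.det T ∧
      (∀ (e : Module.Basis (Fin k) ℝ L)
        (f : Module.Basis (Fin k) ℂ (rMinus L (gaussian c A))),
        c' = c * (((2 * Real.pi) ^ ((k : ℝ) / 2) : ℝ) : ℂ) * sqrtDet T /
          (jacobianMinus μ Pm e f : ℂ)) := by
  obtain ⟨σ, hσ⟩ := exists_sub_snd_mem_rPerp (c := c) hA hIm hc hiso hproj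
  set ψ := gaussian c A with hψ
  set R := complexify L ⊔ rPerp L ψ with hR
  have hLR : complexify L ≤ R := le_sup_left
  have hC : Function.Bijective (projQ (sGerm ψ)) := bijective_projQ_sGerm hA hc
  have hC' : Function.Bijective (projQ R) := bijective_projQ_sup hA hIm hc hiso hproj hσ
  have hσL := projection_complexify hA hIm hiso hproj hσ
  have hσP := fun {W} => projection_rPerp (W := W) hA hIm hc hiso hproj hσ
  have hσR := fun {Y} => sub_projection_mem_rPerp (Y := Y) hA hIm hc hiso hproj hσ
  let Pm : complexify L →ₗ[ℂ] rMinus L ψ :=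
    ((germProj A).domRestrict (complexify L)).codRestrict _
      fun Z => germProj_mem_rMinus hA hIm hc Z.2
  have hPmZ : ∀ Z, (Pm Z : Phase ℂ n) = germProj A Z := fun _ => rfl
  let Pr : R →ₗ[ℂ] complexify L := σ ∘ₗ projQ R
  have hPrY : ∀ Y, Pr Y = σ (Y : Phase ℂ n).2 := fun _ => rfl
  -- 𝒫₋ = P₋Π + (1 − Π).
  let PP : R →ₗ[ℂ] sGerm ψ :=
    (germProj A ∘ₗ (complexify L).subtype ∘ₗ Pr +
      (R.subtype - (complexify L).subtype ∘ₗ Pr)).codRestrict _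
      fun Y => Submodule.add_mem _ (germProj_mem_sGerm hA hc _) (hσR Y.2).1
  have hPPY : ∀ Y : R, (PP Y : Phase ℂ n) =
      germProj A (σ (Y : Phase ℂ n).2) + ((Y : Phase ℂ n) - σ (Y : Phase ℂ n).2) := fun _ => rfl
  have hPPL : ∀ (Y : R) (hY : (Y : Phase ℂ n) ∈ complexify L),
      (PP Y : Phase ℂ n) = germProj A Y := fun Y hY => by
    rw [hPPY, hσL ⟨Y, hY⟩, sub_self, add_zero]
  let T : complexify L →ₗ[ℂ] complexify L :=
    Pr ∘ₗ projQInv hC' ∘ₗ projQ (sGerm ψ) ∘ₗ PP ∘ₗ Submodule.inclusion hLR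
  -- Π after Č⁻¹ is σ, and C𝒫₋ on L^ℂ reads off the germ coordinate.
  have hT : ∀ Z, T Z = σ (germCoord A Z) := fun Z => by
    have h1 : (PP (Submodule.inclusion hLR Z) : Phase ℂ n).2 = germCoord A Z :=
      congrArg Prod.snd (hPPL (Submodule.inclusion hLR Z) Z.2)
    have h2 := (LinearEquiv.ofBijective (projQ R) hC').apply_symm_apply
      (PP (Submodule.inclusion hLR Z) : Phase ℂ n).2
    rw [← h1]
    exact congrArg σ h2
  set A' := LinearMap.toMatrix' (projP R ∘ₗ projQInv hC') with hA'def
  have hA' : ∀ v, A' *ᵥ v = (σ v : Phase ℂ n).1 + A *ᵥ (v - (σ v : Phase ℂ n).2) := fun v => by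
    have h1 : projQInv hC' v = ⟨_, section_mem hσ v⟩ := projQInv_eq hC' (section_snd v)
    rw [hA'def, LinearMap.toMatrix'_mulVec, LinearMap.comp_apply, h1, mulVec_sub]
    rfl
  have hexp : ∀ X : L, (projQInv hC (projQ R ⟨toC (X : Phase ℝ n), hLR (inC L X).2⟩) :
      Phase ℂ n) = graphMap A (toC (X : Phase ℝ n)).2 := fun X =>
    congrArg Subtype.val (projQInv_eq hC
      (Y := ⟨graphMap A (toC (X : Phase ℝ n)).2, graphMap_mem_sGerm hA hc _⟩) rfl)
  have hdirac := integral_expOmega_gaussian hA hIm hiso hproj μ hσ hA'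
  refine ⟨R, hLR, hC, hC', Pm, Pr, PP, A', _, T, hGerm_eq hA hIm hc hiso μ,
    ⟨fun X => ?_, fun Pm' hPm' => ?_, ?_, ?_⟩, ⟨fun Y => hσR Y.2, fun Pr' hPr' => ?_⟩,
    ⟨⟨fun Y hY => ?_, hPPL⟩, fun PP' hPP' => ?_⟩,
    fun ξ => ⟨integrable_expOmega_gaussian hA hIm hiso hproj μ ξ, hdirac ξ⟩,
    fun φ => pairing_integral_expOmega c hIm hproj μ φ hdirac, rfl, ?_, ?_, rfl,
    fun z hz => re_pos_of_hasEigenvalue hA hIm hc hiso hproj hσ hT hz, sqrtDet_sq T,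
    fun e f => ?_⟩
  · have h := germProj_add_star hIm (toC (X : Phase ℝ n))
    rw [star_toC] at h
    exact h.symm
  · refine (complexBasis (Module.finBasis ℝ L)).ext fun a => Subtype.ext ?_
    rw [complexBasis_apply]
    set X := Module.finBasis ℝ L a
    have h1 := hPm' X
    have h2 := germProj_add_star hIm (toC (X : Phase ℝ n))
    rw [star_toC] at h2
    -- The difference D of two candidates lies in r and satisfies D + D^* = 0 on real vectors, so D
    -- = 0 there; real vectors span L^ℂ.
    refine sub_eq_zero.1 (eq_zero_of_add_star_eq_zero hA hIm hc
      (Submodule.sub_mem _ (Pm' (inC L X)).2.1 (Pm (inC L X)).2.1)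
      (Submodule.sub_mem _ (Pm' (inC L X)).2.1 (Pm (inC L X)).2.1) ?_)
    rw [star_sub, sub_add_sub_comm, ← h1]
    exact sub_eq_zero.2 h2.symm
  · refine (injective_iff_map_eq_zero _).2 fun Z hZ => Subtype.ext ?_
    have h0 : germProj A (Z : Phase ℂ n) = 0 := congrArg Subtype.val hZ
    exact eq_zero_of_omega_germProj hA hIm hc hiso Z.2 fun X _ => by rw [h0, omega_zero_left]
  · intro Y
    obtain ⟨Z, hZ, hW⟩ := exists_germProj_sub_mem_rPerp hA hIm hc hiso Y.2.1
    refine ⟨⟨Z, hZ⟩, Subtype.ext (sub_eq_zero.1 ?_).symm⟩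
    exact eq_zero_of_mem_rMinus_of_mem_rPerp hA hIm hc
      (Submodule.sub_mem _ Y.2 (germProj_mem_rMinus hA hIm hc hZ)) hW
  · refine LinearMap.ext fun Y => ?_
    -- Applying σ to the Q-part of Y − Π'Y ∈ r_⊥ gives 0, while σ fixes Π'Y.
    have h := hσP (hPr' Y)
    rw [Prod.snd_sub, map_sub, hσL, sub_eq_zero] at h
    exact h.symm
  · rw [hPPY, hσP hY]
    simp
  · refine LinearMap.ext fun Y => Subtype.ext ?_
    have hW : (Y : Phase ℂ n) - σ (Y : Phase ℂ n).2 ∈ rPerp L ψ := hσR Y.2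
    have hY : Y = ⟨_, hLR (σ (Y : Phase ℂ n).2).2⟩ + ⟨_, (le_sup_right : _ ≤ R) hW⟩ :=
      Subtype.ext (by simp)
    have h1 := hPP'.2 ⟨_, hLR (σ (Y : Phase ℂ n).2).2⟩ (σ (Y : Phase ℂ n).2).2
    have h2 := hPP'.1 ⟨_, (le_sup_right : _ ≤ R) hW⟩ hW
    conv_lhs => rw [hY]
    rw [map_add, Submodule.coe_add, h1, h2, hPPY]
    rfl
  · simp only [hexp]
    exact integrable_exp_omega hA hIm hiso hproj μ
  · simp only [hexp]
  · have hJ := ENNReal.toReal_ne_zero.2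
      ⟨measure_parallelepiped_ne_zero μ e, measure_parallelepiped_ne_top μ e⟩
    have hd := (Real.sqrt_pos.2 (posDef_gramMatrix hA hIm hiso e).det_pos).ne'
    rw [integral_exp_omega μ e, gaussConst_diracMatrix hA hIm hc hiso hproj e hσ hT,
      jacobianMinus_eq hA hIm hiso μ hPmZ e f]
    have hJc := ofReal_ne_zero.2 hJ
    have hdc := ofReal_ne_zero.2 hd
    push_cast
    field_simp
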